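/- **Setting.** There is a set $M$ of $m$ items and two players. A valuation is a function $v:2^M\to\mathbb R$; it is normalized if $v(\emptyset)=0$ and monotone if $S\subseteq T$ implies $v(S)\le v(T)$. It is *gross substitutes* if for all price vectors $p\le p'$ in $\mathbb R^M$ and every $S\in\arg\max_T\{v(T)-\sum_{j\in T}p_j\}$ there is $S'\in\arg\max_T\{v(T)-\sum_{j\in T}p'_j\}$ with $S\cap\{j: p_j=p'_j\}\subseteq S'$. Let $\mathcal V_{m,k}$ be the set of normalized, monotone, gross substitutes valuations on $m$ items all of whose bundle values are nonnegative rationals with numerator and denominator less than $2^k$. An allocation is a pair of disjoint bundles (not all items need be allocated). A *mechanism* is a finite protocol tree in the blackboard model: at each internal node both players simultaneously and publicly send one of finitely many messages (a player with a single possible message is silent), the pair of messages determines the next node, and each leaf is labelled with an allocation $(S_1,S_2)$ and real payments $(p_1,p_2)$. Sending one of $q$ possible messages costs $\lceil\log_2 q\rceil$ bits, and the communication complexity is the maximum total number of bits over root-to-leaf paths. The mechanism is *normalized* if at every leaf a player who receives the empty bundle pays $0$. A strategy $\mathcal S_i$ assigns to each valuation of player $i$ a choice of message at every internal node; the profit of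 player $i$ is $v_i(S_i)-p_i$. The mechanism *implements a welfare maximizer in dominant strategies* on $\mathcal V_{m,k}$ if there are strategies $(\mathcal S_1,\mathcal S_2)$ such that for all $(v_1,v_2)\in\mathcal V_{m,k}^2$ the allocation reached maximizes $v_1(S_1)+v_2(S_2)$ over all allocations, and for every player $i$ and $v_i\in\mathcal V_{m,k}$, playing $\mathcal S_i(v_i)$ gives player $i$ at least the profit of any other choice of messages, whatever choice of messages at the nodes the other player makes. It *implements a welfare maximizer in ex-post equilibrium* on $\mathcal V_{m,k}$ if there are strategies for which the allocation reached is again always welfare-maximizing, and for every player $i$, all $v_i,v_i'\in\mathcal V_{m,k}$ and every valuation $v_{-i}\in\mathcal V_{m,k}$ of the other player, the profit (with respect to $v_i$) of player $i$ at the outcome reached for $(v_i,v_{-i})$ is at least that at the outcome reached for $(v_i',v_{-i})$. **Theorem.** 1. There are constants $c>0$ and $K,m_0\in\mathbb N$ such that for all $m\ge m_0$ and all $k\ge K\lceil\log_2 m\rceil$, every normalized mechanism that implements a welfare maximizer on $\mathcal V_{m,k}$ in dominant strategies has communication complexity at least $2^{cm}$. 2. There are constants $C,d\in\mathbb N$ such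 that for all $m$ and $k$ there is a normalized mechanism that implements a welfare maximizer on $\mathcal V_{m,k}$ in ex-post equilibrium with communication complexity at most $C(m+k+1)^d$. In particular, if $k=k(m)\ge m$ is polynomial in $m$, dominant-strategy implementation requires communication exponential in $m$, whereas $\mathrm{poly}(m)$ communication suffices for ex-post implementation. -/

import Mathlib

/-! ## Valuations -/

/-- The demand set of the valuation `v` at the price vector `p`: the bundles that maximize
`v T - ∑ j ∈ T, p j`. -/
def demandSet {M : Type*} (v : Finset M → ℝ) (p : M → ℝ) : Set (Finset M) :=
  {S | ∀ T : Finset M, v T - ∑ j ∈ T, p j ≤ v S - ∑ j ∈ S, p j}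

/-- Gross substitutes: when prices weakly increase from `p` to `p'`, for every bundle `S` demanded
at `p` some bundle demanded at `p'` contains all the items of `S` whose price did not change. -/
def IsGrossSubstitutes {M : Type*} (v : Finset M → ℝ) : Prop :=
  ∀ p p' : M → ℝ, p ≤ p' → ∀ S ∈ demandSet v p,
    ∃ S' ∈ demandSet v p', ∀ j ∈ S, p j = p' j → j ∈ S'

/-- Every bundle value is a nonnegative rational number whose numerator and (positive) denominator
are `k`-bit integers. -/
def HasBitValues {M : Type*} (k : ℕ) (v : Finset M → ℝ) : Prop :=
  ∀ S : Finset M, ∃ a b : ℕ, a < 2 ^ k ∧ 0 < b ∧ b < 2 ^ k ∧ v S = (a : ℝ) / (b : ℝ)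

/-- The domain of each player: normalized, monotone, gross substitutes valuations on `m` items with
`k`-bit bundle values. -/
def gsDomain (m k : ℕ) : Set (Finset (Fin m) → ℝ) :=
  {v | v ∅ = 0 ∧ Monotone v ∧ IsGrossSubstitutes v ∧ HasBitValues k v}

/-! ## Blackboard protocols -/

/-- A (deterministic) protocol tree with player set `ι` and leaf labels in `O`. At an internal node
every player `i` publicly and simultaneously sends one of `k i + 1` messages, and the message
profile determines the next node. A player with `k i = 0` has a single message: he is silent. -/
inductive Protocol (ι : Type) (O : Type) : Type
  | leaf (o : O) : Protocol ι O
  | node (k : ι → ℕ) (next : (∀ i, Fin (k i + 1)) → Protocol ι O) : Protocol ι O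

namespace Protocol

variable {ι : Type} {O : Type}

/-- A plan of action of player `i`: a message of `i` for every internal node of the tree. -/
def Plan (i : ι) : Protocol ι O → Type
  | leaf _ => Unit
  | node k next => Fin (k i + 1) × (∀ z : ∀ j, Fin (k j + 1), Plan i (next z))

/-- The label of the leaf that is reached when every player `i` follows the plan `b i`. -/
def play : (P : Protocol ι O) → (∀ i, Plan i P) → O
  | leaf o, _ => o
  | node _ next, b => play (next fun i => (b i).1) fun i => (b i).2 fun j => (b j).1

/-- Communication cost: the maximum, over root-to-leaf paths, of the total number of bits sent,
where sending one of `k` possible messages costs `⌈log₂ k⌉` bits. -/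
def cost [Fintype ι] [DecidableEq ι] : Protocol ι O → ℕ
  | leaf _ => 0
  | node k next => (∑ i, Nat.clog 2 (k i + 1)) + Finset.univ.sup fun z => cost (next z)

end Protocol

/-! ## Auction mechanisms -/

/-- An outcome of a combinatorial auction: pairwise disjoint bundles for the players, and the
payment of every player. -/
structure Outcome (ι M : Type) where
  bundle : ι → Finset M
  disjoint : Pairwise fun i j => Disjoint (bundle i) (bundle j)
  payment : ι → ℝ

/-- The profit of player `i` with valuation `v`: the value of his bundle minus his payment. -/
def Outcome.profit {ι M : Type} (o : Outcome ι M) (i : ι) (v : Finset M → ℝ) : ℝ :=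
  v (o.bundle i) - o.payment i

/-- The bundles of `o` maximize the social welfare for the valuation profile `v` among all
allocations of the items. -/
def Outcome.MaximizesWelfare {ι M : Type} [Fintype ι] (o : Outcome ι M)
    (v : ι → Finset M → ℝ) : Prop :=
  ∀ B : ι → Finset M, (Pairwise fun i j => Disjoint (B i) (B j)) →
    ∑ i, v i (B i) ≤ ∑ i, v i (o.bundle i)

/-- A mechanism for a combinatorial auction: a protocol tree whose leaves specify the outcome. -/
abbrev Mechanism (ι M : Type) : Type := Protocol ι (Outcome ι M)

namespace Mechanism

variable {ι M : Type}

/-- The price of the empty bundle is always zero. (Every leaf is reached by some plans.) -/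
def IsNormalized (P : Mechanism ι M) : Prop :=
  ∀ (b : ∀ i, P.Plan i) (i : ι), (P.play b).bundle i = ∅ → (P.play b).payment i = 0

/-- A strategy profile: for each player, a plan of action for every valuation. -/
abbrev Strategies (P : Mechanism ι M) : Type := ∀ i : ι, (Finset M → ℝ) → P.Plan i

/-- The outcome when all players follow the strategies `s` with the valuations `v`. -/
def outcome (P : Mechanism ι M) (s : P.Strategies) (v : ι → Finset M → ℝ) : Outcome ι M :=
  P.play fun i => s i (v i)

/-- The strategies `s` yield a welfare-maximizing allocation for all valuations in `V`. -/
def FindsWelfareMaximizer [Fintype ι] (P : Mechanism ι M) (s : P.Strategies)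
    (V : Set (Finset M → ℝ)) : Prop :=
  ∀ v : ι → Finset M → ℝ, (∀ i, v i ∈ V) → (P.outcome s v).MaximizesWelfare v

/-- For every player `i` and every valuation in `V`, following `s i` is optimal for `i` whatever
the others do: the profile `b` of plans contains arbitrary plans of the others and an arbitrary
deviation `b i` of player `i`. -/
def IsDominant [DecidableEq ι] (P : Mechanism ι M) (s : P.Strategies)
    (V : Set (Finset M → ℝ)) : Prop :=
  ∀ (i : ι), ∀ v ∈ V, ∀ b : (∀ j, P.Plan j),
    (P.play b).profit i v ≤ (P.play (Function.update b i (s i v))).profit i v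

/-- The social choice function and payments computed by `s` are ex-post incentive compatible: when
the other players act according to their valuations, no player gains by acting according to
another valuation `w`. -/
def IsExPost [DecidableEq ι] (P : Mechanism ι M) (s : P.Strategies)
    (V : Set (Finset M → ℝ)) : Prop :=
  ∀ v : ι → Finset M → ℝ, (∀ i, v i ∈ V) → ∀ (i : ι), ∀ w ∈ V,
    (P.outcome s (Function.update v i w)).profit i (v i) ≤ (P.outcome s v).profit i (v i)

/-- The mechanism implements a welfare maximizer on `V` in dominant strategies. -/
def ImplementsInDominantStrategies [Fintype ι] [DecidableEq ι] (P : Mechanism ι M)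
    (V : Set (Finset M → ℝ)) : Prop :=
  ∃ s : P.Strategies, P.IsDominant s V ∧ P.FindsWelfareMaximizer s V

/-- The mechanism implements a welfare maximizer on `V` in ex-post equilibrium. -/
def ImplementsInExPostEquilibrium [Fintype ι] [DecidableEq ι] (P : Mechanism ι M)
    (V : Set (Finset M → ℝ)) : Prop :=
  ∃ s : P.Strategies, P.IsExPost s V ∧ P.FindsWelfareMaximizer s V

end Mechanism

/-! Lower bound. Player 0 is additive. Player 1 has `Λ` times a strictly concave function of the
cardinality, lowered by `Λ` on a sparse family of bundles; sparsity keeps this M♮-concave, hence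
gross substitutes (`isMNatConcave_dippedConcave`). Normalization and incentive constraints pin
player 0's payment to his externality up to one unit per item (`abs_payment_sub_le`), so a dip at
the complement of a bundle makes that bundle dearer by about `Λ`. The relevant bundles are the
vertices of a cube of dimension `2h`. Player 1's type is a labelling of the vertices, with dips at
its isolated zeros. Player 0's type is a vertex (he wants exactly that bundle) or an edge (he takes
one endpoint, avoiding a dipped one). Suppose that, after player 1's messages so far, some possible
labelling dips `x` and another dips its neighbour `y`. If the types `x` and `xy` now sent different
messages, player 1 could continue as the first labelling after one and as the second after the
other. No valuation prescribes this plan, but dominance must withstand it, and `x` would gain by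
imitating `xy`: same bundle, price lower by about `Λ`. So both send the same message. These
equalities propagate along rows and columns of the cube (`eq_of_mem_clearSet`): the relevant types
of player 0 stay indistinguishable until at least `2^h` vertices are isolated zeros of no remaining
labelling. Only a doubly exponentially small fraction of labellings misses so many vertices
(`card_no_isolatedZero_le`), so player 1 must first send exponentially many bits
(`Protocol.card_le_two_pow_cost_mul`).

Upper bound. Tiny weights make the optimal allocation unique with a quantified gap. Approximate
Kelso–Crawford equilibrium prices then certify it: each certificate is a rectangle of valuation
pairs coloured by player 0's bundle, and intersecting rectangles have equal colours
(`eq_optimalBundle_of_accept`). A cover by such rectangles yields a deterministic protocol of cost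
polylogarithmic in their number for each item (`achieves_of_cover`). Exchanging four values then
gives the externality payments, whose truthfulness is the usual Vickrey–Clarke–Groves argument. -/

/-! ## M♮-concavity and gross substitutes -/

/-- The exchange property of M♮-concave set functions. -/
def IsMNatConcave {M : Type*} [DecidableEq M] (v : Finset M → ℝ) : Prop :=
  ∀ S T : Finset M, ∀ i ∈ S \ T,
    v S + v T ≤ v (S.erase i) + v (insert i T) ∨
      ∃ j ∈ T \ S, v S + v T ≤ v (insert j (S.erase i)) + v (insert i (T.erase j))

theorem demandSet_nonempty {M : Type*} [Finite M] (v : Finset M → ℝ) (p : M → ℝ) :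
    (demandSet v p).Nonempty :=
  Finite.exists_max fun T : Finset M => v T - ∑ j ∈ T, p j

/-- Choose a bundle demanded at `p'` that retains as many unchanged-price items of `S` as possible.
If `j` were missing, exchange `j` between `S` and it: optimality of `S` at `p` forces the exchanged
bundle to be demanded at `p'` too, and it retains more. -/
theorem IsMNatConcave.isGrossSubstitutes {M : Type*} [Finite M] [DecidableEq M]
    {v : Finset M → ℝ} (hv : IsMNatConcave v) : IsGrossSubstitutes v := by
  classical
  intro p p' hp S hS
  obtain ⟨S', hS', hmax⟩ := Set.Finite.exists_maximalFor
    (fun T : Finset M => (S.filter fun j => p j = p' j ∧ j ∈ T).card) (demandSet v p')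
    (Set.toFinite _) (demandSet_nonempty v p')
  refine ⟨S', hS', fun j hjS hpj => ?_⟩
  by_contra hj
  have key : ∀ T ∈ demandSet v p', j ∈ T → (∀ l ∈ S, l ∈ S' → l ∈ T) → False := by
    intro T hT hjT hsub
    have hlt : (S.filter fun l => p l = p' l ∧ l ∈ S').card <
        (S.filter fun l => p l = p' l ∧ l ∈ T).card := by
      apply Finset.card_lt_card
      refine ⟨fun l hl => ?_, fun h => ?_⟩
      · simp only [Finset.mem_filter] at hl ⊢
        exact ⟨hl.1, hl.2.1, hsub l hl.1 hl.2.2⟩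
      · have : j ∈ S.filter fun l => p l = p' l ∧ l ∈ T := by simp [hjS, hpj, hjT]
        have := h this
        simp [hj] at this
    exact absurd (hmax hT hlt.le) (not_le.mpr hlt)
  rcases hv S S' j (by simp [hjS, hj]) with h | ⟨l, hl, h⟩
  · refine key (insert j S') (fun T => ?_) (by simp) (by intro l _ h; simp [h])
    have h1 := hS (S.erase j)
    have h2 := hS' T
    rw [← Finset.sum_erase_add _ _ hjS] at h1
    rw [Finset.sum_insert hj]
    linarith
  · simp only [Finset.mem_sdiff] at hl
    have hlj : l ≠ j := by rintro rfl; exact hj hl.1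
    refine key (insert j (S'.erase l)) (fun T => ?_) (by simp) ?_
    · have h1 := hS (insert l (S.erase j))
      have h2 := hS' T
      rw [Finset.sum_insert (by simp [hl.2]), ← Finset.sum_erase_add S _ hjS] at h1
      rw [Finset.sum_insert (by simp [hj])]
      rw [← Finset.sum_erase_add S' _ hl.1] at h2
      have := hp l
      linarith
    · intro i hi hi'
      have : i ≠ l := by rintro rfl; exact hl.2 hi
      simp [this, hi']

/-- The additive valuation with item values `c`. -/
def additive {M : Type*} (c : M → ℝ) (S : Finset M) : ℝ := ∑ j ∈ S, c j

theorem isGrossSubstitutes_additive {M : Type*} [Finite M] [DecidableEq M] (c : M → ℝ) :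
    IsGrossSubstitutes (additive c) := by
  refine IsMNatConcave.isGrossSubstitutes fun S T i hi => Or.inl ?_
  simp only [Finset.mem_sdiff] at hi
  rw [additive, additive, additive, additive, Finset.sum_insert hi.2,
    ← Finset.sum_erase_add S _ hi.1]
  linarith

theorem IsGrossSubstitutes.add_additive {M : Type*} {v : Finset M → ℝ}
    (hv : IsGrossSubstitutes v) (c : M → ℝ) :
    IsGrossSubstitutes fun S => v S + additive c S := by
  have h : ∀ p, demandSet (fun S => v S + additive c S) p = demandSet v (p - c) := by
    intro p
    ext S
    simp only [demandSet, additive, Set.mem_ofPred_eq, Pi.sub_apply, Finset.sum_sub_distrib]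
    refine forall_congr' fun T => ?_
    constructor <;> intro h <;> linarith
  intro p p' hp S hS
  rw [h] at hS
  obtain ⟨S', hS', hs⟩ := hv (p - c) (p' - c) (sub_le_sub_right hp c) S hS
  refine ⟨S', by rwa [h], fun j hj hpj => hs j hj ?_⟩
  simp [hpj]

/-! ## A strictly concave function of the cardinality with isolated dips -/

/-- Membership in `D` as a number. -/
noncomputable def dip {M : Type*} (D : Set (Finset M)) (T : Finset M) : ℝ :=
  by classical exact if T ∈ D then 1 else 0

theorem dip_of_mem {M : Type*} {D : Set (Finset M)} {T : Finset M} (h : T ∈ D) : dip D T = 1 := by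
  simp [dip, h]

theorem dip_of_notMem {M : Type*} {D : Set (Finset M)} {T : Finset M} (h : T ∉ D) :
    dip D T = 0 := by
  simp [dip, h]

theorem dip_nonneg {M : Type*} (D : Set (Finset M)) (T : Finset M) : 0 ≤ dip D T := by
  by_cases h : T ∈ D
  · simp [dip_of_mem h]
  · simp [dip_of_notMem h]

theorem dip_le_one {M : Type*} (D : Set (Finset M)) (T : Finset M) : dip D T ≤ 1 := by
  by_cases h : T ∈ D
  · simp [dip_of_mem h]
  · simp [dip_of_notMem h]

/-- A multiple of a strictly concave function of the cardinality, lowered on the bundles in `D`. -/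
noncomputable def dippedConcave {M : Type*} [Fintype M] (Λ : ℝ) (D : Set (Finset M))
    (T : Finset M) : ℝ :=
  Λ * ((T.card : ℝ) * (2 * Fintype.card M + 2 - T.card) - dip D T)

/-- The members of `D` have the same size and any two of them differ in at least two exchanges. -/
def IsSparse {M : Type*} [DecidableEq M] (D : Set (Finset M)) : Prop :=
  ∀ A ∈ D, ∀ B ∈ D, A.card = B.card ∧ (A ≠ B → 2 ≤ (A \ B).card)

/-- Strict concavity pays for the dips when the cardinalities are far apart. Otherwise an exchange
can preserve the pair of cardinalities, and sparsity leaves so few dipped candidates that some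
exchange avoids them, apart from degenerate cases where `S` and `T` merely swap roles. -/
theorem isMNatConcave_dippedConcave {M : Type*} [Fintype M] [DecidableEq M] {Λ : ℝ} (hΛ : 0 ≤ Λ)
    {D : Set (Finset M)} (hD : IsSparse D) : IsMNatConcave (dippedConcave Λ D) := by
  intro S T i hi
  simp only [Finset.mem_sdiff] at hi
  obtain ⟨hiS, hiT⟩ := hi
  have s1 : ∀ j j', insert j (S.erase i) \ insert j' (S.erase i) ⊆ {j} := by
    intro j j' a; simp only [Finset.mem_sdiff, Finset.mem_insert, Finset.mem_singleton]; tauto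
  have s2 : ∀ j j', insert i (T.erase j) \ insert i (T.erase j') ⊆ {j'} := by
    intro j j' a
    simp only [Finset.mem_sdiff, Finset.mem_insert, Finset.mem_singleton, Finset.mem_erase]; tauto
  have s3 : ∀ j ∈ T, ∀ j', j' ∉ S → j ≠ j' →
      insert j (S.erase i) \ insert i (T.erase j') ⊆ (S \ T).erase i := by
    intro j hj j' hj' hne a
    simp only [Finset.mem_sdiff, Finset.mem_insert, Finset.mem_erase]; grind
  have s4 : ∀ j, j ∉ S → S.erase i \ insert i (T.erase j) ⊆ (S \ T).erase i := by
    intro j hj a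
    simp only [Finset.mem_sdiff, Finset.mem_insert, Finset.mem_erase]; grind
  have s5 : ∀ j ∈ T, insert j (S.erase i) \ insert i T ⊆ (S \ T).erase i := by
    intro j hj a
    simp only [Finset.mem_sdiff, Finset.mem_insert, Finset.mem_erase]; grind
  have n1 : ∀ j ∈ T, i ∉ insert j (S.erase i) := by
    intro j hj
    have : i ≠ j := by rintro rfl; exact hiT hj
    simp [this]
  have hsub : ∀ {A B}, A ∈ D → B ∈ D → A ≠ B →
      ∀ {s : Finset M}, s.card ≤ 1 → A \ B ⊆ s → False := by
    intro A B hA hB hAB s hs hsub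
    have h1 := (hD A hA B hB).2 hAB
    have h2 := Finset.card_le_card hsub
    omega
  have hlow : ∀ S' T' : Finset M, ((S'.card = S.card ∧ T'.card = T.card) ∨
      (S'.card = T.card ∧ T'.card = S.card)) → dip D S' + dip D T' ≤ dip D S + dip D T →
      dippedConcave Λ D S + dippedConcave Λ D T ≤
        dippedConcave Λ D S' + dippedConcave Λ D T' := by
    intro S' T' hc hd
    unfold dippedConcave
    rw [← mul_add, ← mul_add]
    refine mul_le_mul_of_nonneg_left ?_ hΛ
    rcases hc with ⟨h1, h2⟩ | ⟨h1, h2⟩ <;> rw [h1, h2] <;> linarith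
  have hclean : ∀ S' T' : Finset M, ((S'.card = S.card ∧ T'.card = T.card) ∨
      (S'.card = T.card ∧ T'.card = S.card)) → S' ∉ D → T' ∉ D →
      dippedConcave Λ D S + dippedConcave Λ D T ≤
        dippedConcave Λ D S' + dippedConcave Λ D T' := by
    intro S' T' hc h1 h2
    refine hlow S' T' hc ?_
    rw [dip_of_notMem h1, dip_of_notMem h2]
    have := dip_nonneg D S
    have := dip_nonneg D T
    linarith
  have hce : (S.erase i).card + 1 = S.card := Finset.card_erase_add_one hiS
  have hci : (insert i T).card = T.card + 1 := Finset.card_insert_of_notMem hiT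
  -- Moving `i` gains at least 2 in the concave part, while the two new bundles lose at most 1 each.
  by_cases hgap : T.card + 2 ≤ S.card
  · left
    unfold dippedConcave
    rw [← mul_add, ← mul_add]
    refine mul_le_mul_of_nonneg_left ?_ hΛ
    rw [hci, ← hce]
    have h1 : (T.card : ℝ) + 1 ≤ (S.erase i).card := by
      have : T.card + 1 ≤ (S.erase i).card := by omega
      exact_mod_cast this
    have := dip_nonneg D S
    have := dip_nonneg D T
    have := dip_le_one D (S.erase i)
    have := dip_le_one D (insert i T)
    push_cast
    nlinarith
  have hcard : ∀ j ∈ T \ S, (insert j (S.erase i)).card = S.card ∧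
      (insert i (T.erase j)).card = T.card := by
    intro j hj
    simp only [Finset.mem_sdiff] at hj
    rw [Finset.card_insert_of_notMem (by simp [hj.2]), hce,
      Finset.card_insert_of_notMem (by simp [hiT]), Finset.card_erase_add_one hj.1]
    exact ⟨rfl, rfl⟩
  have hst : (S \ T).card + T.card = (T \ S).card + S.card := by
    have h1 := Finset.card_sdiff_add_card_inter S T
    have h2 := Finset.card_sdiff_add_card_inter T S
    rw [Finset.inter_comm] at h2
    omega
  have hiST : i ∈ S \ T := by simp [hiS, hiT]
  by_cases hex : ∃ j ∈ T \ S, insert j (S.erase i) ∉ D ∧ insert i (T.erase j) ∉ D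
  · obtain ⟨j, hj, h1, h2⟩ := hex
    exact Or.inr ⟨j, hj, hclean _ _ (Or.inl (hcard j hj)) h1 h2⟩
  -- Every swap now hits `D`. Swaps hitting it on the same side give bundles one exchange apart, so
  -- each side accounts for at most one `j` and `T \ S` has at most two elements; two is excluded by
  -- comparing the two sides.
  have hor : ∀ j ∈ T \ S, insert j (S.erase i) ∈ D ∨ insert i (T.erase j) ∈ D := by
    intro j hj
    by_contra h
    rw [not_or] at h
    exact hex ⟨j, hj, h⟩
  have hP : ∀ j ∈ T \ S, ∀ j' ∈ T \ S, insert j (S.erase i) ∈ D → insert j' (S.erase i) ∈ D →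
      j = j' := by
    intro j hj j' hj' h h'
    by_contra hne
    simp only [Finset.mem_sdiff] at hj hj'
    refine hsub h h' (fun he => ?_) (s := {j}) (by simp) (s1 j j')
    have : j ∈ insert j' (S.erase i) := by rw [← he]; simp
    simp [hne, hj.2] at this
  have hQ : ∀ j ∈ T \ S, ∀ j' ∈ T \ S, insert i (T.erase j) ∈ D → insert i (T.erase j') ∈ D →
      j = j' := by
    intro j hj j' hj' h h'
    by_contra hne
    simp only [Finset.mem_sdiff] at hj hj'
    refine hsub h h' (fun he => ?_) (s := {j'}) (by simp) (s2 j j')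
    have : j ∈ insert i (T.erase j) := by rw [he]; simp [hne, hj.1]
    have hji : j ≠ i := by rintro rfl; exact hiT hj.1
    simp [hji] at this
  have hcE : ((S \ T).erase i).card + 1 = (S \ T).card := Finset.card_erase_add_one hiST
  have hPQ : ∀ j ∈ T \ S, ∀ j' ∈ T \ S, j ≠ j' → (T \ S).card ≤ 2 →
      insert j (S.erase i) ∈ D → insert i (T.erase j') ∈ D → False := by
    intro j hj j' hj' hne h2 h h'
    have hc := (hD _ h _ h').1
    rw [(hcard j hj).1, (hcard j' hj').2] at hc
    simp only [Finset.mem_sdiff] at hj hj'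
    refine hsub h h' (fun he => ?_) (s := (S \ T).erase i) (by omega) (s3 j hj.1 j' hj'.2 hne)
    exact n1 j hj.1 (by rw [he]; simp)
  rcases Nat.lt_or_ge 1 (T \ S).card with h1 | h1
  · exfalso
    obtain ⟨a, ha, b, hb, hab⟩ := Finset.one_lt_card.mp h1
    have h2 : (T \ S).card ≤ 2 := by
      by_contra h3
      obtain ⟨a, ha, b, hb, c, hc, hab, hac, hbc⟩ := Finset.two_lt_card.mp (not_le.mp h3)
      rcases hor a ha with h | h <;> rcases hor b hb with h' | h' <;> rcases hor c hc with h'' | h''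
      · exact hab (hP a ha b hb h h')
      · exact hab (hP a ha b hb h h')
      · exact hac (hP a ha c hc h h'')
      · exact hbc (hQ b hb c hc h' h'')
      · exact hbc (hP b hb c hc h' h'')
      · exact hac (hQ a ha c hc h h'')
      · exact hab (hQ a ha b hb h h')
      · exact hab (hQ a ha b hb h h')
    rcases hor a ha with h | h <;> rcases hor b hb with h' | h'
    · exact hab (hP a ha b hb h h')
    · exact hPQ a ha b hb hab h2 h h'
    · exact hPQ b hb a ha hab.symm h2 h' h
    · exact hab (hQ a ha b hb h h')
  rcases Nat.eq_zero_or_pos (T \ S).card with h0 | h0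
  · left
    have hTS : T ⊆ S := by
      rw [Finset.card_eq_zero, Finset.sdiff_eq_empty_iff_subset] at h0
      exact h0
    have he : S = insert i T := by
      refine (Finset.eq_of_subset_of_card_le ?_ ?_).symm
      · exact Finset.insert_subset hiS hTS
      · rw [hci]; omega
    refine hlow _ _ (Or.inr ?_) ?_
    · omega
    · rw [← he, he, Finset.erase_insert hiT, ← he]
      linarith
  · obtain ⟨j, hj⟩ := Finset.card_eq_one.mp (le_antisymm h1 h0)
    have hjm : j ∈ T \ S := by rw [hj]; simp
    have hjm' := hjm
    simp only [Finset.mem_sdiff] at hjm'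
    have h11 : (T \ S).card = 1 := le_antisymm h1 h0
    -- If `S` has one item more than `T`, moving `i` alone swaps the cardinalities, and a dip there
    -- would be one exchange away from the dip given by `hor`. Otherwise the swap just interchanges
    -- `S` and `T`.
    rcases Nat.lt_or_ge 1 (S \ T).card with h2 | h2
    · left
      have hc2 : S.card = T.card + 1 := by omega
      refine hclean _ _ (Or.inr (by omega)) (fun h => ?_) (fun h => ?_)
      · have hc := fun X hX => (hD _ h X hX).1
        rcases hor j hjm with h' | h'
        · have := hc _ h'
          rw [(hcard j hjm).1] at this
          omega
        · refine hsub h h' (fun he => ?_) (s := (S \ T).erase i) (by omega) (s4 j hjm'.2)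
          have : i ∈ S.erase i := by rw [he]; simp
          simp at this
      · have hc := fun X hX => (hD X hX _ h).1
        rcases hor j hjm with h' | h'
        · refine hsub h' h (fun he => ?_) (s := (S \ T).erase i) (by omega) (s5 j hjm'.1)
          exact n1 j hjm'.1 (by rw [he]; simp)
        · have := hc _ h'
          rw [(hcard j hjm).2, hci] at this
          omega
    · right
      have hone : (S \ T).card = 1 := by
        have := Finset.card_pos.mpr ⟨i, hiST⟩
        omega
      obtain ⟨i', hi'⟩ := Finset.card_eq_one.mp hone
      have hii : ∀ a, a ∈ S \ T ↔ a = i := by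
        have : i' = i := by rw [hi'] at hiST; exact (Finset.mem_singleton.mp hiST).symm
        simp [hi', this]
      have hjj : ∀ a, a ∈ T \ S ↔ a = j := by simp [hj]
      refine ⟨j, hjm, ?_⟩
      have e1 : insert j (S.erase i) = T := by
        ext a
        have h1 := hii a
        have h2 := hjj a
        simp only [Finset.mem_sdiff] at h1 h2
        simp only [Finset.mem_insert, Finset.mem_erase]
        tauto
      have e2 : insert i (T.erase j) = S := by
        ext a
        have h1 := hii a
        have h2 := hjj a
        simp only [Finset.mem_sdiff] at h1 h2
        simp only [Finset.mem_insert, Finset.mem_erase]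
        tauto
      rw [e1, e2, add_comm]

/-! ## Valuations with integer values -/

theorem hasBitValues_of_nat {M : Type*} {k : ℕ} (hk : 0 < k) {v : Finset M → ℝ}
    (h : ∀ S, ∃ a : ℕ, a < 2 ^ k ∧ v S = a) : HasBitValues k v := by
  intro S
  obtain ⟨a, ha, hv⟩ := h S
  exact ⟨a, 1, ha, one_pos, Nat.one_lt_two_pow hk.ne', by simp [hv]⟩

theorem additive_mem_gsDomain {m k : ℕ} (hk : 0 < k) (c : Fin m → ℕ) (hc : ∑ j, c j < 2 ^ k) :
    additive (fun j => (c j : ℝ)) ∈ gsDomain m k := by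
  refine ⟨by simp [additive], fun S T hST => ?_, isGrossSubstitutes_additive _,
    hasBitValues_of_nat hk fun S => ⟨∑ j ∈ S, c j, ?_, by simp [additive]⟩⟩
  · exact Finset.sum_le_sum_of_subset_of_nonneg hST fun j _ _ => by positivity
  · exact (Finset.sum_le_sum_of_subset (Finset.subset_univ S)).trans_lt hc

theorem dippedConcave_insert {M : Type*} [Fintype M] [DecidableEq M] {Λ : ℝ}
    {D : Set (Finset M)} {T : Finset M} {j : M} (hj : j ∉ T) :
    dippedConcave Λ D (insert j T) = dippedConcave Λ D T +
      Λ * (2 * Fintype.card M + 1 - 2 * T.card + dip D T - dip D (insert j T)) := by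
  unfold dippedConcave
  rw [Finset.card_insert_of_notMem hj]
  push_cast
  ring

theorem exists_nat_dip {M : Type*} (D : Set (Finset M)) (T : Finset M) :
    ∃ d : ℕ, d ≤ 1 ∧ dip D T = d := by
  by_cases h : T ∈ D
  · exact ⟨1, le_rfl, by simp [dip_of_mem h]⟩
  · exact ⟨0, zero_le_one, by simp [dip_of_notMem h]⟩

/-- In units of `Λ` the undipped marginals are odd integers from 3 to `2 * Fintype.card M + 1`, and
dips shift them by at most 1. The slack of 2 at both ends makes the forced choices in later welfare
comparisons strict. -/
theorem dippedConcave_marginal {M : Type*} [Fintype M] [DecidableEq M] {Λ : ℕ} (hΛ : 0 < Λ)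
    (D : Set (Finset M)) {T : Finset M} {j : M} (hj : j ∉ T) :
    ∃ z : ℕ, 2 ≤ z ∧ z + 2 ≤ Λ * (2 * Fintype.card M + 4) ∧
      dippedConcave Λ D (insert j T) = dippedConcave Λ D T + z := by
  obtain ⟨d, hd, hdT⟩ := exists_nat_dip D T
  obtain ⟨e, he, heT⟩ := exists_nat_dip D (insert j T)
  have hc : T.card + 1 ≤ Fintype.card M := by
    rw [← Finset.card_insert_of_notMem hj]
    exact Finset.card_le_univ _
  obtain ⟨r, hr⟩ := Nat.exists_eq_add_of_le hc
  have hx : 2 * Fintype.card M + 1 - 2 * (T.card : ℝ) + d - e = ((2 * r + 3 + d - e : ℕ) : ℝ) := by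
    rw [Nat.cast_sub (by omega), hr]
    push_cast
    ring
  refine ⟨Λ * (2 * r + 3 + d - e), ?_, ?_, ?_⟩
  · have h2 : 2 ≤ 2 * r + 3 + d - e := by omega
    calc 2 ≤ 1 * (2 * r + 3 + d - e) := by omega
      _ ≤ _ := Nat.mul_le_mul_right _ hΛ
  · have h2 : 2 * r + 3 + d - e ≤ 2 * Fintype.card M + 2 := by omega
    have h3 := Nat.mul_le_mul_left Λ h2
    have : Λ * (2 * Fintype.card M + 4) = Λ * (2 * Fintype.card M + 2) + Λ * 2 := by ring
    omega
  · rw [dippedConcave_insert hj, hdT, heT, hx]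
    push_cast
    ring

theorem dippedConcave_mem_gsDomain {m k Λ : ℕ} (hk : 0 < k) (hΛ : 0 < Λ)
    {D : Set (Finset (Fin m))} (hD : IsSparse D) (h0 : ∅ ∉ D)
    (hb : Λ * (m * (2 * m + 4)) < 2 ^ k) : dippedConcave (Λ : ℝ) D ∈ gsDomain m k := by
  have hv0 : dippedConcave (Λ : ℝ) D ∅ = 0 := by simp [dippedConcave, dip_of_notMem h0]
  refine ⟨hv0, Finset.monotone_iff_forall_le_insert.mpr fun T j hj => ?_,
    (isMNatConcave_dippedConcave (by positivity) hD).isGrossSubstitutes,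
    hasBitValues_of_nat hk fun S => ?_⟩
  · obtain ⟨z, -, -, h⟩ := dippedConcave_marginal hΛ D hj
    rw [h]
    simp
  · have : ∃ a : ℕ, a ≤ S.card * (Λ * (2 * m + 4)) ∧ dippedConcave (Λ : ℝ) D S = a := by
      induction S using Finset.induction_on with
      | empty => exact ⟨0, by simp, by simp [hv0]⟩
      | insert j S hj ih =>
        obtain ⟨a, ha, hS⟩ := ih
        obtain ⟨z, -, hz, h⟩ := dippedConcave_marginal hΛ D hj
        refine ⟨a + z, ?_, by rw [h, hS]; push_cast; ring⟩
        rw [Finset.card_insert_of_notMem hj, add_one_mul]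
        simp only [Fintype.card_fin] at hz
        omega
    obtain ⟨a, ha, hS⟩ := this
    refine ⟨a, lt_of_le_of_lt (ha.trans ?_) hb, hS⟩
    calc S.card * (Λ * (2 * m + 4)) ≤ m * (Λ * (2 * m + 4)) :=
          Nat.mul_le_mul_right _ (by simpa using Finset.card_le_univ S)
      _ = _ := by ring

/-! ## Welfare maximization for an additive player against a strictly monotone player -/

/-- All marginal values are integers between `2` and `H - 2`. -/
def HasMarginals {M : Type*} [DecidableEq M] (H : ℕ) (u : Finset M → ℝ) : Prop :=
  ∀ T : Finset M, ∀ j ∉ T, ∃ z : ℕ, 2 ≤ z ∧ z + 2 ≤ H ∧ u (insert j T) = u T + z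

section TwoPlayers

variable {m : ℕ} {v u : Finset (Fin m) → ℝ} {o : Outcome (Fin 2) (Fin m)}

theorem Outcome.MaximizesWelfare.two (h : o.MaximizesWelfare ![v, u]) {A B : Finset (Fin m)}
    (hAB : Disjoint A B) : v A + u B ≤ v (o.bundle 0) + u (o.bundle 1) := by
  have := h ![A, B] (by
    intro i j hij
    fin_cases i <;> fin_cases j <;> simp_all [disjoint_comm])
  simpa [Fin.sum_univ_two] using this

theorem Outcome.MaximizesWelfare.bundle_one {H : ℕ} (h : o.MaximizesWelfare ![v, u])
    (hu : HasMarginals H u) : o.bundle 1 = (o.bundle 0)ᶜ := by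
  have hd : Disjoint (o.bundle 0) (o.bundle 1) := o.disjoint (by decide)
  ext j
  rw [Finset.mem_compl]
  constructor
  · exact fun h1 h0 => Finset.disjoint_left.mp hd h0 h1
  · intro h0
    by_contra h1
    obtain ⟨z, hz, -, hzu⟩ := hu _ j h1
    have := h.two (A := o.bundle 0) (B := insert j (o.bundle 1)) (by
      rw [Finset.disjoint_insert_right]
      exact ⟨h0, hd⟩)
    rw [hzu] at this
    have : (2 : ℝ) ≤ z := by exact_mod_cast hz
    linarith

theorem Outcome.MaximizesWelfare.le_compl {H : ℕ} (h : o.MaximizesWelfare ![v, u])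
    (hu : HasMarginals H u) (A : Finset (Fin m)) :
    v A + u Aᶜ ≤ v (o.bundle 0) + u (o.bundle 0)ᶜ := by
  rw [← h.bundle_one hu]
  exact h.two disjoint_compl_right

theorem compl_erase_eq {A : Finset (Fin m)} {j : Fin m} : (A.erase j)ᶜ = insert j Aᶜ := by
  ext a; simp

theorem compl_insert_insert {A : Finset (Fin m)} {j : Fin m} (hj : j ∉ A) :
    insert j (insert j A)ᶜ = Aᶜ := by
  ext a; simp; grind

theorem Outcome.MaximizesWelfare.notMem {H : ℕ} {c : Fin m → ℕ}
    (h : o.MaximizesWelfare ![additive fun j => (c j : ℝ), u]) (hu : HasMarginals H u)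
    {j : Fin m} (hj : c j = 0) : j ∉ o.bundle 0 := by
  intro hm
  have h1 := h.le_compl hu ((o.bundle 0).erase j)
  obtain ⟨z, hz, -, hzu⟩ := hu (o.bundle 0)ᶜ j (by simpa using hm)
  rw [compl_erase_eq, hzu] at h1
  simp only [additive] at h1
  rw [← Finset.sum_erase_add _ _ hm, hj] at h1
  have : (2 : ℝ) ≤ z := by exact_mod_cast hz
  push_cast at h1
  linarith

theorem Outcome.MaximizesWelfare.mem {H : ℕ} {c : Fin m → ℕ}
    (h : o.MaximizesWelfare ![additive fun j => (c j : ℝ), u]) (hu : HasMarginals H u)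
    {j : Fin m} (hj : c j = H) : j ∈ o.bundle 0 := by
  by_contra hm
  have h1 := h.le_compl hu (insert j (o.bundle 0))
  obtain ⟨z, -, hz, hzu⟩ := hu (insert j (o.bundle 0))ᶜ j (by simp)
  rw [compl_insert_insert hm] at hzu
  rw [hzu] at h1
  simp only [additive] at h1
  rw [Finset.sum_insert hm, hj] at h1
  have : (z : ℝ) + 2 ≤ H := by exact_mod_cast hz
  linarith

/-- The item values `H` on `A`, `a` on the items of `K` and `0` elsewhere. -/
def threeValues (H : ℕ) (A K : Finset (Fin m)) (a : ℕ) (j : Fin m) : ℕ :=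
  if j ∈ A then H else if j ∈ K then a else 0

theorem sum_threeValues_le {H a : ℕ} (ha : a ≤ H) (A K : Finset (Fin m)) :
    ∑ j, threeValues H A K a j ≤ m * H := by
  calc ∑ j, threeValues H A K a j ≤ ∑ _j : Fin m, H := by
        refine Finset.sum_le_sum fun j _ => ?_
        unfold threeValues
        split_ifs <;> omega
    _ = _ := by simp

theorem Outcome.MaximizesWelfare.subset_threeValues {H a : ℕ} {A K : Finset (Fin m)}
    (h : o.MaximizesWelfare ![additive fun j => (threeValues H A K a j : ℝ), u])
    (hu : HasMarginals H u) : A ⊆ o.bundle 0 ∧ o.bundle 0 ⊆ A ∪ K := by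
  refine ⟨fun j hj => h.mem hu (by simp [threeValues, hj]), fun j hj => ?_⟩
  by_contra hA
  rw [Finset.mem_union, not_or] at hA
  exact h.notMem hu (by simp [threeValues, hA]) hj

theorem sum_threeValues_insert {H a : ℕ} {A K B : Finset (Fin m)} {j : Fin m} (hB : j ∉ B)
    (hA : j ∉ A) (hK : j ∈ K) :
    additive (fun j => (threeValues H A K a j : ℝ)) (insert j B) =
      additive (fun j => (threeValues H A K a j : ℝ)) B + a := by
  rw [additive, additive, Finset.sum_insert hB]
  simp [threeValues, hA, hK, add_comm]

theorem Outcome.MaximizesWelfare.bundle_threeValues_empty {H a : ℕ} {A : Finset (Fin m)}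
    (h : o.MaximizesWelfare ![additive fun j => (threeValues H A ∅ a j : ℝ), u])
    (hu : HasMarginals H u) : o.bundle 0 = A := by
  have := h.subset_threeValues hu
  rw [Finset.union_empty] at this
  exact this.2.antisymm this.1

theorem Outcome.MaximizesWelfare.bundle_threeValues_singleton {H a : ℕ} {A : Finset (Fin m)}
    {j : Fin m} (hj : j ∉ A)
    (h : o.MaximizesWelfare ![additive fun i => (threeValues H A {j} a i : ℝ), u])
    (hu : HasMarginals H u) :
    (u Aᶜ < u (insert j A)ᶜ + a → o.bundle 0 = insert j A) ∧
      (u (insert j A)ᶜ + a < u Aᶜ → o.bundle 0 = A) := by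
  obtain ⟨h1, h2⟩ := h.subset_threeValues hu
  have hor : o.bundle 0 = A ∨ o.bundle 0 = insert j A := by
    by_cases hjo : j ∈ o.bundle 0
    · right
      refine Finset.Subset.antisymm (fun i hi => ?_) (Finset.insert_subset hjo h1)
      have := h2 hi
      simp at this ⊢
      tauto
    · left
      refine Finset.Subset.antisymm (fun i hi => ?_) h1
      have := h2 hi
      simp at this
      rcases this with rfl | h
      · exact absurd hi hjo
      · exact h
  have hs := sum_threeValues_insert (H := H) (a := a) hj hj (Finset.mem_singleton_self j)
  have hA := h.le_compl hu A
  have hA' := h.le_compl hu (insert j A)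
  constructor <;> intro hlt <;> rcases hor with h' | h'
  · rw [h', hs] at hA'
    linarith
  · exact h'
  · exact h'
  · rw [h', hs] at hA
    linarith

theorem Outcome.MaximizesWelfare.bundle_threeValues_pair {H a : ℕ} {A : Finset (Fin m)}
    {i j : Fin m} (hi : i ∉ A) (hj : j ∉ A) (hij : i ≠ j)
    (h : o.MaximizesWelfare ![additive fun l => (threeValues H A {i, j} a l : ℝ), u])
    (hu : HasMarginals H u) (h1 : u Aᶜ < u (insert i A)ᶜ + a)
    (h2 : u (insert j (insert i A))ᶜ + a < u (insert i A)ᶜ)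
    (h3 : u (insert j A)ᶜ < u (insert i A)ᶜ) : o.bundle 0 = insert i A := by
  obtain ⟨hs1, hs2⟩ := h.subset_threeValues hu
  have hA := h.le_compl hu (insert i A)
  have ei := sum_threeValues_insert (H := H) (a := a) (K := {i, j}) hi hi (by simp)
  have ej := sum_threeValues_insert (H := H) (a := a) (K := {i, j}) hj hj (by simp)
  have eij := sum_threeValues_insert (H := H) (a := a) (A := A) (K := {i, j})
    (B := insert i A) (j := j) (by simp [hij.symm, hj]) hj (by simp)
  have hor : o.bundle 0 = A ∨ o.bundle 0 = insert i A ∨ o.bundle 0 = insert j A ∨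
      o.bundle 0 = insert j (insert i A) := by
    have hall : ∀ l, l ∈ o.bundle 0 ↔ l ∈ A ∨ (l = i ∧ i ∈ o.bundle 0) ∨
        (l = j ∧ j ∈ o.bundle 0) := by
      intro l
      constructor
      · intro hl
        have := hs2 hl
        simp only [Finset.mem_union, Finset.mem_insert, Finset.mem_singleton] at this
        rcases this with h | rfl | rfl <;> tauto
      · rintro (h | ⟨rfl, h⟩ | ⟨rfl, h⟩)
        · exact hs1 h
        · exact h
        · exact h
    by_cases hio : i ∈ o.bundle 0 <;> by_cases hjo : j ∈ o.bundle 0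
    · right; right; right; ext l; rw [hall]; simp [hio, hjo]; tauto
    · right; left; ext l; rw [hall]; simp [hio, hjo]; tauto
    · right; right; left; ext l; rw [hall]; simp [hio, hjo]; tauto
    · left; ext l; rw [hall]; simp [hio, hjo]
  rcases hor with h' | h' | h' | h'
  · rw [h', ei] at hA
    linarith
  · exact h'
  · rw [h', ei, ej] at hA
    linarith
  · rw [h', eij, ei] at hA
    linarith

/-- The payments of an incentive compatible, normalized, welfare-maximizing direct mechanism are
almost the externalities imposed on the other player. -/
theorem abs_payment_sub_le {H k : ℕ} (hk : 0 < k) (hH : m * H < 2 ^ k) (hu : HasMarginals H u)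
    (out : (Finset (Fin m) → ℝ) → Outcome (Fin 2) (Fin m))
    (hopt : ∀ v ∈ gsDomain m k, (out v).MaximizesWelfare ![v, u])
    (hIC : ∀ v ∈ gsDomain m k, ∀ w ∈ gsDomain m k,
      (out w).profit 0 v ≤ (out v).profit 0 v)
    (hnorm : ∀ v ∈ gsDomain m k, (out v).bundle 0 = ∅ → (out v).payment 0 = 0)
    (A : Finset (Fin m)) : ∀ v ∈ gsDomain m k, (out v).bundle 0 = A →
      |(out v).payment 0 - (u Finset.univ - u Aᶜ)| ≤ A.card := by
  induction A using Finset.induction_on with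
  | empty =>
    intro v hv h
    simp [hnorm v hv h]
  | insert j A hj ih =>
    intro v hv h
    obtain ⟨z, hz2, hzH, hz⟩ := hu (insert j A)ᶜ j (by simp)
    rw [compl_insert_insert hj] at hz
    have hmem : ∀ a ≤ H, additive (fun i => (threeValues H A {j} a i : ℝ)) ∈ gsDomain m k :=
      fun a ha => additive_mem_gsDomain hk _ ((sum_threeValues_le ha _ _).trans_lt hH)
    -- Player 1 values `j` at `z` here, so a value of `z + 1` makes player 0 buy `j` on top of `A`,
    -- and `z - 1` makes him stop at `A`. Incentive compatibility between these two types puts the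
    -- price difference in `[z - 1, z + 1]`, an error of one per item.
    have hp := hmem (z + 1) (by omega)
    have hq := hmem (z - 1) (by omega)
    have hz1 : ((z - 1 : ℕ) : ℝ) = z - 1 := by
      rw [Nat.cast_sub (by omega)]
      simp
    have bp := (((hopt _ hp).bundle_threeValues_singleton hj hu).1) (by rw [hz]; push_cast; linarith)
    have bq := (((hopt _ hq).bundle_threeValues_singleton hj hu).2) (by rw [hz, hz1]; linarith)
    have h1 := hIC _ hp _ hq
    have h2 := hIC _ hq _ hp
    -- Both types receive the same bundle, so they pay the same.
    have h3 := hIC _ hv _ hp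
    have h4 := hIC _ hp _ hv
    have h5 := ih _ hq bq
    simp only [Outcome.profit, bp, bq, h] at h1 h2 h3 h4
    rw [sum_threeValues_insert hj hj (by simp)] at h1 h2
    rw [hz1] at h2
    push_cast at h1
    rw [Finset.card_insert_of_notMem hj]
    rw [hz] at h5
    rw [abs_le] at h5 ⊢
    push_cast
    constructor <;> linarith

end TwoPlayers

/-! ## Two-player protocols -/

namespace Protocol

/-- The profile consisting of `a` for player `0` and `b` for player `1`. -/
def two {T : Fin 2 → Type*} (a : T 0) (b : T 1) : (i : Fin 2) → T i
  | 0 => a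
  | 1 => b

theorem eq_two {T : Fin 2 → Type*} (f : (i : Fin 2) → T i) : f = two (f 0) (f 1) := by
  funext i
  fin_cases i <;> rfl

theorem play_node {ι O : Type} {k : ι → ℕ} {next : (∀ i, Fin (k i + 1)) → Protocol ι O}
    (b : ∀ i, Plan i (node k next)) {w : ∀ i, Fin (k i + 1)} (hw : (fun i => (b i).1) = w) :
    play (node k next) b = play (next w) fun i => (b i).2 w := by
  subst hw
  rfl

theorem play_node_two {O : Type} {k : Fin 2 → ℕ}
    {next : (∀ i, Fin (k i + 1)) → Protocol (Fin 2) O}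
    (p : Plan 0 (node k next)) (q : Plan 1 (node k next)) :
    play (node k next) (two p q) =
      play (next (two p.1 q.1)) (two (p.2 (two p.1 q.1)) (q.2 (two p.1 q.1))) := by
  have h1 : (fun i => (two (T := fun i => Plan i (node k next)) p q i).1) = two p.1 q.1 := by
    rw [eq_two (fun i => (two (T := fun i => Plan i (node k next)) p q i).1)]
    rfl
  rw [play_node _ h1]
  congr 1
  funext i
  fin_cases i <;> rfl

theorem play_node_two_of_eq {O : Type} {k : Fin 2 → ℕ}
    {next : (∀ i, Fin (k i + 1)) → Protocol (Fin 2) O}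
    (p : Plan 0 (node k next)) (q : Plan 1 (node k next)) {y : Fin (k 1 + 1)} (hy : q.1 = y) :
    play (node k next) (two p q) =
      play (next (two p.1 y)) (two (p.2 (two p.1 y)) (q.2 (two p.1 y))) := by
  subst hy
  exact play_node_two p q

instance nonempty_plan {ι O : Type} (i : ι) : (P : Protocol ι O) → Nonempty (P.Plan i)
  | leaf _ => ⟨()⟩
  | node _ next => ⟨(0, fun z => (nonempty_plan i (next z)).some)⟩

/-- `Y` is the set of player 1's types consistent with his messages. While `Y` is not `Revealed`,
`hconn` makes all alive types of player 0 send one message, so only player 1's message splits `Y`.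
By `hleaf`, no leaf can be reached with a nonempty unrevealed `Y`; hence `Y` breaks into at most `2
^ cost` pieces of size at most `B`. -/
theorem card_le_two_pow_cost_mul {M A Ξ : Type} (val : A → Finset M → ℝ)
    (Spec : A → Ξ → Outcome (Fin 2) M → Prop) (alive : Finset Ξ → Set A)
    (Revealed : Finset Ξ → Prop) (B : ℕ)
    (halive : ∀ Y Y', Y' ⊆ Y → alive Y' ⊆ alive Y)
    (hB : ∀ Y, Revealed Y → Y.card ≤ B)
    (hconn : ∀ Y, ¬ Revealed Y → ∀ {γ : Type} (f : A → γ),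
      (∀ a ∈ alive Y, ∀ a' ∈ alive Y, (∃ ξ ∈ Y, ∃ ξ' ∈ Y, ∀ o o', Spec a ξ o → Spec a' ξ' o' →
        o.profit 0 (val a) < o'.profit 0 (val a)) → f a = f a') →
      ∀ a ∈ alive Y, ∀ a' ∈ alive Y, f a = f a')
    (hleaf : ∀ Y, Y.Nonempty → ¬ Revealed Y → ∀ o, ∃ a ∈ alive Y, ∃ ξ ∈ Y, ¬ Spec a ξ o)
    (P : Protocol (Fin 2) (Outcome (Fin 2) M)) :
    ∀ (α : A → P.Plan 0) (β : Ξ → P.Plan 1) (Y : Finset Ξ),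
      (∀ a ∈ alive Y, ∀ p q, (P.play (two p q)).profit 0 (val a) ≤
        (P.play (two (α a) q)).profit 0 (val a)) →
      (∀ a ∈ alive Y, ∀ ξ ∈ Y, Spec a ξ (P.play (two (α a) (β ξ)))) →
      Y.card ≤ 2 ^ P.cost * B := by
  classical
  induction P with
  | leaf o =>
    intro α β Y _ hspec
    simp only [cost, pow_zero, one_mul]
    by_cases hr : Revealed Y
    · exact hB Y hr
    rcases Y.eq_empty_or_nonempty with rfl | hY
    · simp
    obtain ⟨a, ha, ξ, hξ, h⟩ := hleaf Y hY hr o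
    exact absurd (hspec a ha ξ hξ) h
  | node k next ih =>
    intro α β Y hdom hspec
    set c := Finset.univ.sup fun z => cost (next z) with hc
    have hfib : ∀ y : Fin (k 1 + 1),
        (Y.filter fun ξ => (β ξ).1 = y).card ≤ 2 ^ c * B := by
      intro y
      set Y' := Y.filter fun ξ => (β ξ).1 = y with hY'
      have hsub : Y' ⊆ Y := Finset.filter_subset _ _
      by_cases hr : Revealed Y'
      · exact (hB Y' hr).trans (Nat.le_mul_of_pos_left _ (by positivity))
      have hsame : ∀ a ∈ alive Y', ∀ a' ∈ alive Y', (α a).1 = (α a').1 := by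
        refine hconn Y' hr (fun a => (α a).1) ?_
        rintro a ha a' ha' ⟨ξ, hξ, ξ', hξ', hlt⟩
        by_contra hne
        have hξ1 := (Finset.mem_filter.mp hξ).2
        have hξ1' := (Finset.mem_filter.mp hξ').2
        -- The hybrid plan: act as `ξ'` in the subtree opened by the message of `a'`, and as `ξ`
        -- elsewhere. It is well defined because `ξ` and `ξ'` send the same message `y` at this node
        -- and the messages of `a` and `a'` differ.
        let q : Plan 1 (node k next) :=
          (y, Function.update (β ξ).2 (two (α a').1 y) ((β ξ').2 (two (α a').1 y)))
        have e1 : play (node k next) (two (α a) q) = play (node k next) (two (α a) (β ξ)) := by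
          rw [play_node_two_of_eq _ _ hξ1, play_node_two_of_eq _ q rfl]
          have : two (T := fun i => Fin (k i + 1)) (α a).1 y ≠ two (α a').1 y := by
            intro h
            exact hne (congrFun h 0)
          simp only [q, Function.update_of_ne this]
        have e2 : play (node k next) (two (α a') q) =
            play (node k next) (two (α a') (β ξ')) := by
          rw [play_node_two_of_eq _ _ hξ1', play_node_two_of_eq _ q rfl]
          simp only [q, Function.update_self]
        have h := hdom a (halive _ _ hsub ha) (α a') q
        rw [e1, e2] at h
        exact absurd h (not_le.mpr (hlt _ _
          (hspec a (halive _ _ hsub ha) ξ (hsub hξ))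
          (hspec a' (halive _ _ hsub ha') ξ' (hsub hξ'))))
      obtain ⟨z, hz⟩ : ∃ z, ∀ a ∈ alive Y', (α a).1 = z := by
        by_cases hne : ∃ a, a ∈ alive Y'
        · obtain ⟨a, ha⟩ := hne
          exact ⟨(α a).1, fun a' ha' => hsame a' ha' a ha⟩
        · exact ⟨0, fun a ha => absurd ⟨a, ha⟩ hne⟩
      have hcost : cost (next (two z y)) ≤ c :=
        Finset.le_sup (f := fun z => cost (next z)) (Finset.mem_univ _)
      refine (ih (two z y) (fun a => (α a).2 (two z y)) (fun ξ => (β ξ).2 (two z y)) Y' ?_ ?_).trans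
        (Nat.mul_le_mul_right _ (Nat.pow_le_pow_right two_pos hcost))
      · intro a ha p q
        let p' : Plan 0 (node k next) := (z, Function.update (α a).2 (two z y) p)
        let q' : Plan 1 (node k next) :=
          (y, Function.update (fun _ => Classical.arbitrary _) (two z y) q)
        have h := hdom a (halive _ _ hsub ha) p' q'
        rw [play_node_two_of_eq p' q' rfl, play_node_two_of_eq _ q' rfl, hz a ha] at h
        simp only [p', q', Function.update_self] at h
        exact h
      · intro a ha ξ hξ
        have h := hspec a (halive _ _ hsub ha) ξ (hsub hξ)
        rw [play_node_two_of_eq _ _ (Finset.mem_filter.mp hξ).2, hz a ha] at h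
        exact h
    have hsum : Y.card = ∑ y : Fin (k 1 + 1), (Y.filter fun ξ => (β ξ).1 = y).card :=
      Finset.card_eq_sum_card_fiberwise fun ξ _ => Finset.mem_univ _
    calc Y.card ≤ ∑ _y : Fin (k 1 + 1), 2 ^ c * B := by
          rw [hsum]
          exact Finset.sum_le_sum fun y _ => hfib y
      _ = (k 1 + 1) * (2 ^ c * B) := by simp
      _ ≤ 2 ^ Nat.clog 2 (k 1 + 1) * (2 ^ c * B) :=
          Nat.mul_le_mul_right _ (Nat.le_pow_clog one_lt_two _)
      _ = 2 ^ (Nat.clog 2 (k 1 + 1) + c) * B := by rw [pow_add, mul_assoc]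
      _ ≤ 2 ^ cost (node k next) * B := by
          refine Nat.mul_le_mul_right _ (Nat.pow_le_pow_right two_pos ?_)
          simp only [cost, Fin.sum_univ_two]
          omega

end Protocol

/-! ## Isolated zeros of a random labelling of a graph -/

section IsolatedZeros

variable {V : Type} [DecidableEq V] {q : ℕ}

/-- `Z` does not depend on the coordinate `i`. -/
def IndependentOf (Z : Finset (V → Fin q)) (i : V) : Prop :=
  ∀ ξ c, ξ ∈ Z → Function.update ξ i c ∈ Z

theorem IndependentOf.card_filter_eq {Z : Finset (V → Fin q)} {i : V} (hZ : IndependentOf Z i)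
    (c : Fin q) : (Z.filter fun ξ => ξ i = c).card * q = Z.card := by
  have hle : ∀ c c' : Fin q,
      (Z.filter fun ξ => ξ i = c).card ≤ (Z.filter fun ξ => ξ i = c').card := by
    intro c c'
    refine Finset.card_le_card_of_injOn (fun ξ => Function.update ξ i c') ?_ ?_
    · intro ξ hξ
      simp only [Finset.coe_filter, Set.mem_ofPred_eq] at hξ ⊢
      exact ⟨hZ _ _ hξ.1, by simp⟩
    · intro ξ hξ ξ' hξ' h
      simp only [Finset.coe_filter, Set.mem_ofPred_eq] at hξ hξ'
      funext j
      by_cases hj : j = i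
      · rw [hj, hξ.2, hξ'.2]
      · simpa [hj] using congrFun h j
  have hsum : Z.card = ∑ c' : Fin q, (Z.filter fun ξ => ξ i = c').card :=
    Finset.card_eq_sum_card_fiberwise fun ξ _ => Finset.mem_univ _
  rw [hsum, Finset.sum_congr rfl fun c' _ => le_antisymm (hle c' c) (hle c c')]
  simp [mul_comm]

variable [NeZero q] [Fintype V]

theorem card_filter_forall_ne (Z : Finset (V → Fin q)) (T : Finset V)
    (hZ : ∀ i ∈ T, IndependentOf Z i) :
    ((Z.filter fun ξ => ∀ i ∈ T, ξ i ≠ 0).card : ℝ) = (1 - 1 / q) ^ T.card * Z.card := by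
  have hq : (0 : ℝ) < q := by exact_mod_cast Nat.pos_of_ne_zero (NeZero.ne q)
  induction T using Finset.induction_on with
  | empty => simp
  | insert j T hj ih =>
    set Y := Z.filter fun ξ => ∀ i ∈ T, ξ i ≠ 0 with hY
    have hind : IndependentOf Y j := by
      intro ξ c hξ
      simp only [hY, Finset.mem_filter] at hξ ⊢
      refine ⟨hZ j (by simp) ξ c hξ.1, fun i hi => ?_⟩
      have : i ≠ j := by rintro rfl; exact hj hi
      simpa [this] using hξ.2 i hi
    have h0 := hind.card_filter_eq 0
    have hsplit := Finset.card_filter_add_card_filter_not (s := Y) (fun ξ => ξ j = 0)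
    have he : (Z.filter fun ξ => ∀ i ∈ insert j T, ξ i ≠ 0) = Y.filter fun ξ => ¬ ξ j = 0 := by
      ext ξ
      simp only [hY, Finset.mem_filter, Finset.forall_mem_insert]
      tauto
    have ih' := ih fun i hi => hZ i (by simp [hi])
    rw [he, Finset.card_insert_of_notMem hj, pow_succ]
    have h0' : ((Y.filter fun ξ => ξ j = 0).card : ℝ) * q = Y.card := by exact_mod_cast h0
    have hs' : ((Y.filter fun ξ => ξ j = 0).card : ℝ) + (Y.filter fun ξ => ¬ ξ j = 0).card
      = Y.card := by exact_mod_cast hsplit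
    have : ((Y.filter fun ξ => ξ j = 0).card : ℝ) = Y.card / q := by
      field_simp
      linarith
    rw [mul_right_comm, ← ih', ← hs', this]
    have : ((Y.filter fun ξ => ¬ ξ j = 0).card : ℝ) = Y.card - Y.card / q := by linarith
    rw [this]
    field_simp
    ring

/-- The labelling `ξ` vanishes at `x` and nowhere on `nb x`. -/
def IsolatedZero (nb : V → Finset V) (ξ : V → Fin q) (x : V) : Prop :=
  ξ x = 0 ∧ ∀ w ∈ nb x, ξ w ≠ 0

instance (nb : V → Finset V) (ξ : V → Fin q) (x : V) : Decidable (IsolatedZero nb ξ x) :=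
  inferInstanceAs (Decidable (_ ∧ _))

/-- Within `Z` the labels at `x` and its neighbours are uniform and independent, so an isolated zero
at `x` has probability `(1/q) * (1 - 1/q) ^ (nb x).card`. By Bernoulli's inequality and `2 * n ≤ q`
this is at least `1 / (2 * q)`. -/
theorem card_filter_not_isolatedZero_le {nb : V → Finset V} {n : ℕ}
    (hcard : ∀ x, (nb x).card ≤ n) (hx : ∀ x, x ∉ nb x) (hq : 2 * n ≤ q)
    (Z : Finset (V → Fin q)) (x : V) (hZ : ∀ i ∈ insert x (nb x), IndependentOf Z i) :
    ((Z.filter fun ξ => ¬ IsolatedZero nb ξ x).card : ℝ) ≤ (1 - 1 / (2 * q)) * Z.card := by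
  have hq0 : (0 : ℝ) < q := by exact_mod_cast Nat.pos_of_ne_zero (NeZero.ne q)
  set Y := Z.filter fun ξ => ∀ i ∈ nb x, ξ i ≠ 0 with hY
  have h1 := card_filter_forall_ne Z (nb x) fun i hi => hZ i (by simp [hi])
  rw [← hY] at h1
  have hind : IndependentOf Y x := by
    intro ξ c hξ
    simp only [hY, Finset.mem_filter] at hξ ⊢
    refine ⟨hZ x (by simp) ξ c hξ.1, fun i hi => ?_⟩
    have : i ≠ x := by rintro rfl; exact hx _ hi
    simpa [this] using hξ.2 i hi
  have h2 := hind.card_filter_eq 0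
  have he : (Z.filter fun ξ => IsolatedZero nb ξ x) = Y.filter fun ξ => ξ x = 0 := by
    ext ξ
    simp only [hY, Finset.mem_filter]
    unfold IsolatedZero
    tauto
  have hsplit := Finset.card_filter_add_card_filter_not (s := Z) (fun ξ => IsolatedZero nb ξ x)
  rw [he] at hsplit
  have hpow : (1 / 2 : ℝ) ≤ (1 - 1 / q) ^ (nb x).card := by
    have hb := one_add_mul_le_pow (a := (-(1 / q) : ℝ)) (by
      have : (1 / q : ℝ) ≤ 1 := by
        rw [div_le_one hq0]
        exact_mod_cast Nat.pos_of_ne_zero (NeZero.ne q)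
      linarith) (nb x).card
    have : ((nb x).card : ℝ) * (1 / q) ≤ 1 / 2 := by
      rw [mul_one_div, div_le_iff₀ hq0]
      have h3 : ((nb x).card : ℝ) ≤ n := by exact_mod_cast hcard x
      have h4 : (2 : ℝ) * n ≤ q := by exact_mod_cast hq
      linarith
    rw [sub_eq_add_neg]
    linarith
  have h2' : ((Y.filter fun ξ => ξ x = 0).card : ℝ) * q = Y.card := by exact_mod_cast h2
  have hs' : ((Y.filter fun ξ => ξ x = 0).card : ℝ) +
      (Z.filter fun ξ => ¬ IsolatedZero nb ξ x).card = Z.card := by exact_mod_cast hsplit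
  have h5 : (1 / 2 : ℝ) * Z.card ≤ Y.card := by
    rw [h1]
    exact mul_le_mul_of_nonneg_right hpow (by positivity)
  have h6 : (1 / (2 * q) : ℝ) * Z.card ≤ (Y.filter fun ξ => ξ x = 0).card := by
    rw [div_mul_eq_mul_div, div_le_iff₀ (by positivity)]
    linarith
  linarith

/-- Greedy selection: each chosen vertex discards at most `(n + 1) ^ 2` vertices whose closed
neighbourhoods meet its own. The events at the chosen vertices depend on disjoint sets of
coordinates, so their probabilities multiply. -/
theorem card_no_isolatedZero_le {nb : V → Finset V} {n : ℕ} (hcard : ∀ x, (nb x).card ≤ n)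
    (hx : ∀ x, x ∉ nb x) (hsymm : ∀ x y, y ∈ nb x → x ∈ nb y) (hq : 2 * n ≤ q) (j : ℕ) :
    ∀ U : Finset V, j * (n + 1) ^ 2 ≤ U.card →
      ((Finset.univ.filter fun ξ : V → Fin q => ∀ x ∈ U, ¬ IsolatedZero nb ξ x).card : ℝ) ≤
        (1 - 1 / (2 * q)) ^ j * Fintype.card (V → Fin q) := by
  have hq0 : (1 : ℝ) ≤ q := by exact_mod_cast Nat.pos_of_ne_zero (NeZero.ne q)
  induction j with
  | zero =>
    intro U _
    simpa using (Nat.cast_le (α := ℝ)).mpr (Finset.card_le_univ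
      (Finset.univ.filter fun ξ : V → Fin q => ∀ x ∈ U, ¬ IsolatedZero nb ξ x))
  | succ j ih =>
    intro U hU
    obtain ⟨s, hs⟩ : U.Nonempty := by
      rw [← Finset.card_pos]
      refine lt_of_lt_of_le ?_ hU
      positivity
    let N : V → Finset V := fun x => insert x (nb x)
    have hN : ∀ x, (N x).card ≤ n + 1 := fun x =>
      (Finset.card_insert_le _ _).trans (Nat.succ_le_succ (hcard x))
    have hNs : ∀ x y, y ∈ N x → x ∈ N y := by
      intro x y h
      simp only [N, Finset.mem_insert] at h ⊢
      rcases h with rfl | h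
      · exact Or.inl rfl
      · exact Or.inr (hsymm _ _ h)
    set U' := U.filter fun t => Disjoint (N t) (N s) with hU'
    have hrem : (U.filter fun t => ¬ Disjoint (N t) (N s)).card ≤ (n + 1) ^ 2 := by
      have hsub : (U.filter fun t => ¬ Disjoint (N t) (N s)) ⊆ (N s).biUnion N := by
        intro t ht
        simp only [Finset.mem_filter, Finset.not_disjoint_iff] at ht
        obtain ⟨-, w, hw, hw'⟩ := ht
        exact Finset.mem_biUnion.mpr ⟨w, hw', hNs _ _ hw⟩
      refine (Finset.card_le_card hsub).trans (Finset.card_biUnion_le.trans ?_)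
      calc ∑ w ∈ N s, (N w).card ≤ ∑ _w ∈ N s, (n + 1) := Finset.sum_le_sum fun w _ => hN w
        _ = (N s).card * (n + 1) := by simp
        _ ≤ (n + 1) * (n + 1) := Nat.mul_le_mul_right _ (hN s)
        _ = _ := by ring
    have hsplit := Finset.card_filter_add_card_filter_not (s := U)
      (fun t => Disjoint (N t) (N s))
    rw [← hU'] at hsplit
    have hU'c : j * (n + 1) ^ 2 ≤ U'.card := by
      rw [add_one_mul] at hU
      omega
    set Z := Finset.univ.filter fun ξ : V → Fin q => ∀ x ∈ U', ¬ IsolatedZero nb ξ x with hZ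
    have hind : ∀ i ∈ insert s (nb s), IndependentOf Z i := by
      intro i hi ξ c hξ
      simp only [hZ, Finset.mem_filter, Finset.mem_univ, true_and] at hξ ⊢
      intro x hxU
      have hdis := (Finset.mem_filter.mp hxU).2
      have hne : ∀ w ∈ N x, w ≠ i := by
        rintro w hw rfl
        exact Finset.disjoint_left.mp hdis hw hi
      have := hξ x hxU
      unfold IsolatedZero at this ⊢
      rw [Function.update_of_ne (hne x (by simp [N]))]
      intro hcon
      refine this ⟨hcon.1, fun w hw => ?_⟩
      have h1 := hcon.2 w hw
      rwa [Function.update_of_ne (hne w (by simp [N, hw]))] at h1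
    have hle : (Finset.univ.filter fun ξ : V → Fin q => ∀ x ∈ U, ¬ IsolatedZero nb ξ x) ⊆
        Z.filter fun ξ => ¬ IsolatedZero nb ξ s := by
      intro ξ hξ
      simp only [hZ, Finset.mem_filter, Finset.mem_univ, true_and] at hξ ⊢
      exact ⟨fun x hx => hξ x (Finset.mem_filter.mp hx).1, hξ s hs⟩
    have hnn : (0 : ℝ) ≤ 1 - 1 / (2 * q) := by
      rw [sub_nonneg, div_le_one (by linarith)]
      linarith
    calc ((Finset.univ.filter fun ξ : V → Fin q => ∀ x ∈ U, ¬ IsolatedZero nb ξ x).card : ℝ)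
        ≤ (Z.filter fun ξ => ¬ IsolatedZero nb ξ s).card := by
          exact_mod_cast Finset.card_le_card hle
      _ ≤ (1 - 1 / (2 * q)) * Z.card := card_filter_not_isolatedZero_le hcard hx hq Z s hind
      _ ≤ (1 - 1 / (2 * q)) * ((1 - 1 / (2 * q)) ^ j * Fintype.card (V → Fin q)) :=
          mul_le_mul_of_nonneg_left (ih U' hU'c) hnn
      _ = _ := by ring

end IsolatedZeros

/-! ## The hypercube with two groups of coordinates -/

section Cube

variable {h : ℕ}

/-- The coordinates: two groups of `h` coordinates. -/
abbrev Coord (h : ℕ) : Type := Bool × Fin h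

/-- The vertices of the hypercube. -/
abbrev Vertex (h : ℕ) : Type := Coord h → Bool

/-- Change one coordinate. -/
def flipAt (k : Coord h) (x : Vertex h) : Vertex h := Function.update x k (!x k)

theorem flipAt_apply_self (k : Coord h) (x : Vertex h) : flipAt k x k = !x k := by simp [flipAt]

theorem flipAt_apply_of_ne {k l : Coord h} (hl : l ≠ k) (x : Vertex h) : flipAt k x l = x l := by
  simp [flipAt, hl]

theorem flipAt_flipAt (k : Coord h) (x : Vertex h) : flipAt k (flipAt k x) = x := by
  funext l
  by_cases hl : l = k
  · subst hl; simp [flipAt_apply_self]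
  · simp [flipAt_apply_of_ne hl]

theorem flipAt_ne (k : Coord h) (x : Vertex h) : flipAt k x ≠ x := by
  intro he
  have := congrFun he k
  rw [flipAt_apply_self] at this
  cases hx : x k <;> simp [hx] at this

/-- The neighbours of a vertex. -/
def cubeNb (x : Vertex h) : Finset (Vertex h) := Finset.univ.image fun k => flipAt k x

theorem flipAt_mem_cubeNb (k : Coord h) (x : Vertex h) : flipAt k x ∈ cubeNb x :=
  Finset.mem_image_of_mem _ (Finset.mem_univ k)

theorem card_cubeNb_le (x : Vertex h) : (cubeNb x).card ≤ 2 * h :=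
  Finset.card_image_le.trans (by simp)

theorem notMem_cubeNb (x : Vertex h) : x ∉ cubeNb x := by
  intro hx
  obtain ⟨k, -, hk⟩ := Finset.mem_image.mp hx
  exact flipAt_ne k x hk

theorem cubeNb_symm (x y : Vertex h) (hy : y ∈ cubeNb x) : x ∈ cubeNb y := by
  obtain ⟨k, -, rfl⟩ := Finset.mem_image.mp hy
  have := flipAt_mem_cubeNb k (flipAt k x)
  rwa [flipAt_flipAt] at this

/-- No vertex of `U` has the restriction `a` to the coordinates of the group `s`. -/
def Clear (U : Finset (Vertex h)) (s : Bool) (a : Fin h → Bool) : Prop :=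
  ∀ x : Vertex h, (∀ i, x (s, i) = a i) → x ∉ U

/-- The vertices that lie on a line or column that avoids `U`. -/
def clearSet (U : Finset (Vertex h)) : Set (Vertex h) :=
  {x | ∃ s, Clear U s fun i => x (s, i)}

theorem notMem_of_mem_clearSet {U : Finset (Vertex h)} {x : Vertex h} (hx : x ∈ clearSet U) :
    x ∉ U := by
  obtain ⟨s, hs⟩ := hx
  exact hs x fun _ => rfl

theorem clearSet_anti {U U' : Finset (Vertex h)} (hU : U ⊆ U') : clearSet U' ⊆ clearSet U := by
  rintro x ⟨s, hs⟩
  exact ⟨s, fun y hy hyU => hs y hy (hU hyU)⟩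

/-- Pigeonhole: there are `2 ^ h` parallel subcubes, and each vertex of `U` spoils only one. -/
theorem exists_clear {U : Finset (Vertex h)} (hU : U.card < 2 ^ h) (s : Bool) :
    ∃ a, Clear U s a := by
  have hlt : (U.image fun x : Vertex h => fun i => x (s, i)).card <
      (Finset.univ : Finset (Fin h → Bool)).card := by
    refine lt_of_le_of_lt Finset.card_image_le ?_
    simpa using hU
  obtain ⟨a, -, ha⟩ := Finset.exists_mem_notMem_of_card_lt_card hlt
  refine ⟨a, fun x hx hxU => ha (Finset.mem_image.mpr ⟨x, hxU, ?_⟩)⟩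
  funext i
  exact hx i

theorem eq_of_clear_of_agree {U : Finset (Vertex h)} {γ : Type} (g : Vertex h → γ)
    (hg : ∀ x k, x ∈ clearSet U → flipAt k x ∈ clearSet U → g x = g (flipAt k x))
    {s : Bool} {x y : Vertex h} (hs : Clear U s fun i => x (s, i))
    (hxy : ∀ i, x (s, i) = y (s, i)) : g x = g y := by
  classical
  have key : ∀ T : Finset (Coord h), (∀ k ∈ T, k.1 ≠ s) →
      g (fun k => if k ∈ T then y k else x k) = g x := by
    intro T
    induction T using Finset.induction_on with
    | empty => intro _; simp
    | insert k T hk ih =>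
      intro hT
      have hT' : ∀ l ∈ T, l.1 ≠ s := fun l hl => hT l (by simp [hl])
      rw [← ih hT']
      set z : Vertex h := fun k => if k ∈ T then y k else x k with hz
      set z' : Vertex h := fun l => if l ∈ insert k T then y l else x l with hz'
      have hcl : ∀ w : Vertex h, (∀ i, w (s, i) = x (s, i)) → w ∈ clearSet U := by
        intro w hw
        refine ⟨s, ?_⟩
        simpa [hw] using hs
      have hzs : ∀ i, z (s, i) = x (s, i) := by
        intro i
        have : (s, i) ∉ T := fun hm => hT' _ hm rfl
        simp [hz, this]
      have hzs' : ∀ i, z' (s, i) = x (s, i) := by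
        intro i
        have : (s, i) ∉ insert k T := fun hm => hT _ hm rfl
        simp only [hz', this, if_false]
      have hoff : ∀ l, l ≠ k → z' l = z l := by
        intro l hl
        simp [hz, hz', hl]
      by_cases he : z' k = z k
      · have : z' = z := by
          funext l
          by_cases hl : l = k
          · rw [hl, he]
          · exact hoff l hl
        rw [this]
      · have : z' = flipAt k z := by
          funext l
          by_cases hl : l = k
          · rw [hl, flipAt_apply_self]
            cases h1 : z' k <;> cases h2 : z k <;> simp_all
          · rw [hoff l hl, flipAt_apply_of_ne hl]
        have hfl := hcl _ hzs'
        rw [this] at hfl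
        rw [this]
        exact (hg z k (hcl _ hzs) hfl).symm
  rw [← key (Finset.univ.filter fun k => k.1 ≠ s) (by simp)]
  congr 1
  funext ⟨s', i⟩
  by_cases hs' : s' = s
  · subst hs'
    simp [hxy]
  · simp [hs']

/-- View the cube as a grid with the two coordinate groups as axes. Inside a clear line one moves by
flips without leaving the clear set, and every clear line meets the fixed clear line of the other
direction through `c`. -/
theorem eq_of_mem_clearSet {U : Finset (Vertex h)} (hU : U.card < 2 ^ h) {γ : Type}
    (g : Vertex h → γ)
    (hg : ∀ x k, x ∈ clearSet U → flipAt k x ∈ clearSet U → g x = g (flipAt k x))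
    {x y : Vertex h} (hx : x ∈ clearSet U) (hy : y ∈ clearSet U) : g x = g y := by
  choose a ha using exists_clear hU
  let c : Vertex h := fun k => a k.1 k.2
  have key : ∀ z ∈ clearSet U, g z = g c := by
    rintro z ⟨s, hs⟩
    let w : Vertex h := fun k => if k.1 = s then z k else a k.1 k.2
    have h1 : g z = g w := eq_of_clear_of_agree g hg hs fun i => by simp [w]
    have h2 : g c = g w := eq_of_clear_of_agree g hg (s := !s) (x := c) (by simpa [c] using ha (!s))
      fun i => by simp [c, w]
    rw [h1, h2]
  rw [key x hx, key y hy]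

theorem exists_flipAt_mem_clearSet {U : Finset (Vertex h)} (hU : U.card < 2 ^ h) (hh : 0 < h) :
    ∃ x k, x ∈ clearSet U ∧ flipAt k x ∈ clearSet U := by
  obtain ⟨a, ha⟩ := exists_clear hU true
  refine ⟨fun k => a k.2, (false, ⟨0, hh⟩), ⟨true, ha⟩, ⟨true, ?_⟩⟩
  have : (fun i => flipAt (false, ⟨0, hh⟩) (fun k : Coord h => a k.2) (true, i)) = a := by
    funext i
    rw [flipAt_apply_of_ne (by simp)]
  rw [this]
  exact ha

/-! ## The bundles of the vertices -/

variable {m : ℕ} (ι : Coord h × Bool ↪ Fin m)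

/-- The bundle of a vertex: one of two items for each coordinate. -/
def vertexBundle (x : Vertex h) : Finset (Fin m) :=
  Finset.univ.map ⟨fun k => ι (k, x k), fun _ _ hkl => congrArg Prod.fst (ι.injective hkl)⟩

theorem mem_vertexBundle {x : Vertex h} {j : Fin m} :
    j ∈ vertexBundle ι x ↔ ∃ k, ι (k, x k) = j := by
  simp only [vertexBundle, Finset.mem_map, Finset.mem_univ, true_and]
  rfl

theorem apply_mem_vertexBundle {x : Vertex h} {k : Coord h} {b : Bool} :
    ι (k, b) ∈ vertexBundle ι x ↔ x k = b := by
  rw [mem_vertexBundle]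
  constructor
  · rintro ⟨l, hl⟩
    have := ι.injective hl
    rw [Prod.mk.injEq] at this
    rw [← this.1, this.2]
  · rintro rfl
    exact ⟨k, rfl⟩

theorem card_vertexBundle (x : Vertex h) : (vertexBundle ι x).card = 2 * h := by
  simp [vertexBundle]

theorem vertexBundle_injective : Function.Injective (vertexBundle ι) := by
  intro x y hxy
  funext k
  have : ι (k, x k) ∈ vertexBundle ι y := by
    rw [← hxy]
    exact (apply_mem_vertexBundle ι).mpr rfl
  exact ((apply_mem_vertexBundle ι).mp this).symm

/-- The common part of the bundles of `x` and `flipAt k x`. -/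
def coreBundle (x : Vertex h) (k : Coord h) : Finset (Fin m) :=
  (vertexBundle ι x).erase (ι (k, x k))

theorem coreBundle_flipAt (x : Vertex h) (k : Coord h) :
    coreBundle ι (flipAt k x) k = coreBundle ι x k := by
  ext j
  simp only [coreBundle, Finset.mem_erase, mem_vertexBundle]
  have key : ∀ y : Vertex h, (j ≠ ι (k, y k) ∧ ∃ l, ι (l, y l) = j) ↔
      ∃ l, l ≠ k ∧ ι (l, y l) = j := by
    intro y
    constructor
    · rintro ⟨h1, l, h2⟩
      refine ⟨l, ?_, h2⟩
      rintro rfl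
      exact h1 h2.symm
    · rintro ⟨l, h1, h2⟩
      refine ⟨?_, l, h2⟩
      rintro rfl
      have := ι.injective h2
      exact h1 (by simpa using congrArg Prod.fst this)
  rw [key, key]
  refine exists_congr fun l => and_congr_right fun hl => ?_
  rw [flipAt_apply_of_ne hl]

theorem insert_coreBundle (x : Vertex h) (k : Coord h) :
    insert (ι (k, x k)) (coreBundle ι x k) = vertexBundle ι x :=
  Finset.insert_erase ((apply_mem_vertexBundle ι).mpr rfl)

theorem insert_coreBundle_flipAt (x : Vertex h) (k : Coord h) :
    insert (ι (k, !x k)) (coreBundle ι x k) = vertexBundle ι (flipAt k x) := by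
  rw [← coreBundle_flipAt, ← flipAt_apply_self, insert_coreBundle]

theorem notMem_coreBundle (x : Vertex h) (k : Coord h) (b : Bool) :
    ι (k, b) ∉ coreBundle ι x k := by
  intro hm
  simp only [coreBundle, Finset.mem_erase] at hm
  exact hm.1 (by rw [(apply_mem_vertexBundle ι).mp hm.2])

variable {q : ℕ} [NeZero q]

/-- The complements of the bundles of the isolated zeros of a labelling. -/
def dippedSets (ξ : Vertex h → Fin q) : Set (Finset (Fin m)) :=
  {A | ∃ x, IsolatedZero cubeNb ξ x ∧ (vertexBundle ι x)ᶜ = A}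

theorem compl_vertexBundle_mem_dippedSets {ξ : Vertex h → Fin q} {x : Vertex h} :
    (vertexBundle ι x)ᶜ ∈ dippedSets ι ξ ↔ IsolatedZero cubeNb ξ x := by
  constructor
  · rintro ⟨y, hy, hyx⟩
    rwa [← vertexBundle_injective ι (compl_injective hyx)]
  · exact fun hx => ⟨x, hx, rfl⟩

theorem not_isolatedZero_flipAt {ξ : Vertex h → Fin q} {x : Vertex h} (k : Coord h)
    (hx : IsolatedZero cubeNb ξ x) : ¬ IsolatedZero cubeNb ξ (flipAt k x) :=
  fun hf => hx.2 _ (flipAt_mem_cubeNb k x) hf.1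

theorem card_of_mem_dippedSets {ξ : Vertex h → Fin q} {A : Finset (Fin m)}
    (hA : A ∈ dippedSets ι ξ) : A.card = m - 2 * h := by
  obtain ⟨x, -, rfl⟩ := hA
  rw [Finset.card_compl, card_vertexBundle, Fintype.card_fin]

/-- Two isolated zeros are never adjacent, so they differ in two coordinates, and each of these
contributes an item to the difference. -/
theorem isSparse_dippedSets (ξ : Vertex h → Fin q) : IsSparse (dippedSets ι ξ) := by
  intro A hA B hB
  refine ⟨by rw [card_of_mem_dippedSets ι hA, card_of_mem_dippedSets ι hB], fun hAB => ?_⟩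
  obtain ⟨x, hx, rfl⟩ := hA
  obtain ⟨y, hy, rfl⟩ := hB
  have hxy : x ≠ y := by rintro rfl; exact hAB rfl
  obtain ⟨k, hk⟩ := Function.ne_iff.mp hxy
  have hne : flipAt k x ≠ y := by
    rintro rfl
    exact not_isolatedZero_flipAt k hx hy
  obtain ⟨l, hl⟩ := Function.ne_iff.mp hne
  have hlk : l ≠ k := by
    rintro rfl
    rw [flipAt_apply_self] at hl
    cases h1 : x l <;> cases h2 : y l <;> simp_all
  rw [flipAt_apply_of_ne hlk] at hl
  have hmem : ∀ i, x i ≠ y i → ι (i, y i) ∈ (vertexBundle ι x)ᶜ \ (vertexBundle ι y)ᶜ := by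
    intro i hi
    simp [apply_mem_vertexBundle, hi]
  refine Finset.one_lt_card.mpr ⟨_, hmem k hk, _, hmem l hl, fun he => hlk ?_⟩
  have := ι.injective he
  exact (by simpa using congrArg Prod.fst this : k = l).symm

theorem empty_notMem_dippedSets (hm : 4 * h ≤ m) (hh : 0 < h) (ξ : Vertex h → Fin q) :
    ∅ ∉ dippedSets ι ξ := by
  intro h0
  have := card_of_mem_dippedSets ι h0
  rw [Finset.card_empty] at this
  omega

theorem univ_notMem_dippedSets (hm : 4 * h ≤ m) (hh : 0 < h) (ξ : Vertex h → Fin q) :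
    Finset.univ ∉ dippedSets ι ξ := by
  intro h0
  have := card_of_mem_dippedSets ι h0
  rw [Finset.card_univ, Fintype.card_fin] at this
  omega

end Cube

/-! ## The types of the two players -/

section LowerBound

variable {h m q : ℕ} [NeZero q] (ι : Coord h × Bool ↪ Fin m) (Λ : ℕ)

/-- The types of the additive player: vertices and edges of the hypercube. -/
abbrev AdditiveType (h : ℕ) : Type := Vertex h ⊕ Vertex h × Coord h

/-- The item values of the additive player. -/
def itemValue : AdditiveType h → Fin m → ℕ
  | .inl x => threeValues (Λ * (2 * m + 4)) (vertexBundle ι x) ∅ 0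
  | .inr (x, k) => threeValues (Λ * (2 * m + 4)) (coreBundle ι x k) {ι (k, x k), ι (k, !x k)}
      (Λ * (4 * h + 2))

/-- The valuations of the additive player. -/
noncomputable def additiveValuation (a : AdditiveType h) : Finset (Fin m) → ℝ :=
  additive fun j => (itemValue ι Λ a j : ℝ)

/-- The valuations of the other player. -/
noncomputable def dippedValuation (ξ : Vertex h → Fin q) : Finset (Fin m) → ℝ :=
  dippedConcave (Λ : ℝ) (dippedSets ι ξ)

theorem itemValue_flipAt (x : Vertex h) (k : Coord h) :
    itemValue ι Λ (.inr (flipAt k x, k)) = itemValue ι Λ (.inr (x, k)) := by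
  simp only [itemValue, coreBundle_flipAt, flipAt_apply_self, Bool.not_not]
  rw [Finset.pair_comm]

theorem additiveValuation_mem {k : ℕ} (hk : 0 < k) (hb : m * (Λ * (2 * m + 4)) < 2 ^ k)
    (hm : 4 * h ≤ m) (a : AdditiveType h) : additiveValuation ι Λ a ∈ gsDomain m k := by
  refine additive_mem_gsDomain hk _ (lt_of_le_of_lt ?_ hb)
  rcases a with x | ⟨x, k⟩
  · exact sum_threeValues_le (Nat.zero_le _) _ _
  · exact sum_threeValues_le (Nat.mul_le_mul_left _ (by omega)) _ _

theorem dippedValuation_mem {k : ℕ} (hk : 0 < k) (hΛ : 0 < Λ) (hb : m * (Λ * (2 * m + 4)) < 2 ^ k)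
    (hm : 4 * h ≤ m) (hh : 0 < h) (ξ : Vertex h → Fin q) :
    dippedValuation ι Λ ξ ∈ gsDomain m k :=
  dippedConcave_mem_gsDomain hk hΛ (isSparse_dippedSets ι ξ) (empty_notMem_dippedSets ι hm hh ξ)
    (by rwa [mul_left_comm])

theorem hasMarginals_dippedValuation (hΛ : 0 < Λ) (ξ : Vertex h → Fin q) :
    HasMarginals (Λ * (2 * m + 4)) (dippedValuation ι Λ ξ) := by
  intro T j hj
  simpa [dippedValuation] using dippedConcave_marginal hΛ (dippedSets ι ξ) hj

/-- The price of the bundle of a vertex whose complement is not dipped. -/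
noncomputable def basePrice (h m Λ : ℕ) : ℝ :=
  Λ * (m * (m + 2) - (m - 2 * h) * (m + 2 * h + 2))

variable {ι Λ}

theorem card_compl_vertexBundle (hm : 4 * h ≤ m) (x : Vertex h) :
    (((vertexBundle ι x)ᶜ.card : ℕ) : ℝ) = m - 2 * h := by
  rw [Finset.card_compl, card_vertexBundle, Fintype.card_fin, Nat.cast_sub (by omega)]
  push_cast
  ring

theorem dippedValuation_univ_sub (hm : 4 * h ≤ m) (hh : 0 < h) (ξ : Vertex h → Fin q)
    (x : Vertex h) :
    dippedValuation ι Λ ξ Finset.univ - dippedValuation ι Λ ξ (vertexBundle ι x)ᶜ =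
      basePrice h m Λ + Λ * dip (dippedSets ι ξ) (vertexBundle ι x)ᶜ := by
  unfold dippedValuation dippedConcave basePrice
  rw [dip_of_notMem (univ_notMem_dippedSets ι hm hh ξ), card_compl_vertexBundle hm, Finset.card_univ,
    Fintype.card_fin]
  ring

/-- The edge type's item value `Λ * (4 * h + 2)` lies strictly between player 1's undipped marginals
`Λ * (4 * h + 1)` and `Λ * (4 * h + 3)` on the two sides of size `m - 2 * h`, and the dips here only
help. So player 0 gets exactly one of the two items, and the dip decides which: player 1 must not be
left with the dipped bundle. -/
theorem bundle_of_edge {o : Outcome (Fin 2) (Fin m)} (hΛ : 0 < Λ) (hm : 4 * h ≤ m)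
    {ξ : Vertex h → Fin q} {x : Vertex h} {k : Coord h}
    (ho : o.MaximizesWelfare ![additiveValuation ι Λ (.inr (x, k)), dippedValuation ι Λ ξ])
    (hx : IsolatedZero cubeNb ξ (flipAt k x)) : o.bundle 0 = vertexBundle ι x := by
  have hΛ' : (0 : ℝ) < Λ := by exact_mod_cast hΛ
  have hi := notMem_coreBundle ι x k (x k)
  have hj := notMem_coreBundle ι x k (!x k)
  have hij : ι (k, x k) ≠ ι (k, !x k) := by
    intro he
    have := ι.injective he
    simp at this
  rw [← insert_coreBundle]
  have hnot : (vertexBundle ι x)ᶜ ∉ dippedSets ι ξ := by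
    rw [compl_vertexBundle_mem_dippedSets]
    intro hx'
    exact not_isolatedZero_flipAt k hx' hx
  have hflip : (vertexBundle ι (flipAt k x))ᶜ ∈ dippedSets ι ξ :=
    (compl_vertexBundle_mem_dippedSets ι).mpr hx
  have hcard := card_compl_vertexBundle (ι := ι) hm x
  refine Outcome.MaximizesWelfare.bundle_threeValues_pair hi hj hij ho
    (hasMarginals_dippedValuation ι Λ hΛ ξ) ?_ ?_ ?_
  · have hins := dippedConcave_insert (Λ := (Λ : ℝ)) (D := dippedSets ι ξ)
      (T := (vertexBundle ι x)ᶜ) (j := ι (k, x k)) (by simp [apply_mem_vertexBundle])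
    rw [insert_coreBundle]
    have he : insert (ι (k, x k)) (vertexBundle ι x)ᶜ = (coreBundle ι x k)ᶜ := by
      rw [← insert_coreBundle ι x k, compl_insert_insert hi]
    rw [he, dip_of_notMem hnot, hcard, Fintype.card_fin] at hins
    unfold dippedValuation
    rw [hins]
    have := dip_nonneg (dippedSets ι ξ) (coreBundle ι x k)ᶜ
    push_cast
    nlinarith
  · have hj' : ι (k, !x k) ∉ insert (ι (k, x k)) (coreBundle ι x k) := by
      simp [hj, hij.symm]
    have hins := dippedConcave_insert (Λ := (Λ : ℝ)) (D := dippedSets ι ξ)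
      (T := (insert (ι (k, !x k)) (insert (ι (k, x k)) (coreBundle ι x k)))ᶜ) (j := ι (k, !x k))
      (by simp)
    rw [compl_insert_insert hj', insert_coreBundle, dip_of_notMem hnot] at hins
    have hc : (((insert (ι (k, !x k)) (vertexBundle ι x))ᶜ.card : ℕ) : ℝ) = m - 2 * h - 1 := by
      rw [insert_coreBundle] at hj'
      have := Finset.card_insert_of_notMem (s := (insert (ι (k, !x k)) (vertexBundle ι x))ᶜ)
        (a := ι (k, !x k)) (by simp)
      rw [compl_insert_insert hj'] at this
      rw [← hcard, this]
      push_cast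
      ring
    rw [hc, Fintype.card_fin] at hins
    unfold dippedValuation
    rw [insert_coreBundle, hins]
    have := dip_nonneg (dippedSets ι ξ) (insert (ι (k, !x k)) (vertexBundle ι x))ᶜ
    push_cast
    nlinarith
  · rw [insert_coreBundle, insert_coreBundle_flipAt]
    unfold dippedValuation dippedConcave
    rw [dip_of_notMem hnot, dip_of_mem hflip, card_compl_vertexBundle hm,
      card_compl_vertexBundle hm]
    nlinarith

variable (ι Λ) in
/-- The outcomes that a normalized welfare-maximizing mechanism may choose. -/
def IsPossibleOutcome : AdditiveType h → (Vertex h → Fin q) → Outcome (Fin 2) (Fin m) → Prop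
  | .inl x, ξ, o => o.bundle 0 = vertexBundle ι x ∧
      |o.payment 0 - (basePrice h m Λ + Λ * dip (dippedSets ι ξ) (vertexBundle ι x)ᶜ)| ≤ 2 * h
  | .inr (x, k), ξ, o =>
    (IsolatedZero cubeNb ξ (flipAt k x) → o.bundle 0 = vertexBundle ι x ∧
      |o.payment 0 - basePrice h m Λ| ≤ 2 * h) ∧
    (IsolatedZero cubeNb ξ x → o.bundle 0 = vertexBundle ι (flipAt k x) ∧
      |o.payment 0 - basePrice h m Λ| ≤ 2 * h)

theorem isPossibleOutcome {k : ℕ} (hk : 0 < k) (hΛ : 0 < Λ)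
    (hb : m * (Λ * (2 * m + 4)) < 2 ^ k) (hm : 4 * h ≤ m) (hh : 0 < h) (ξ : Vertex h → Fin q)
    (out : (Finset (Fin m) → ℝ) → Outcome (Fin 2) (Fin m))
    (hopt : ∀ v ∈ gsDomain m k, (out v).MaximizesWelfare ![v, dippedValuation ι Λ ξ])
    (hIC : ∀ v ∈ gsDomain m k, ∀ w ∈ gsDomain m k,
      (out w).profit 0 v ≤ (out v).profit 0 v)
    (hnorm : ∀ v ∈ gsDomain m k, (out v).bundle 0 = ∅ → (out v).payment 0 = 0)
    (a : AdditiveType h) : IsPossibleOutcome ι Λ a ξ (out (additiveValuation ι Λ a)) := by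
  have hu := hasMarginals_dippedValuation ι Λ hΛ ξ
  have hmem := additiveValuation_mem ι Λ hk hb hm
  have hpay : ∀ (x : Vertex h) (b : AdditiveType h),
      (out (additiveValuation ι Λ b)).bundle 0 = vertexBundle ι x →
      |(out (additiveValuation ι Λ b)).payment 0 -
        (basePrice h m Λ + Λ * dip (dippedSets ι ξ) (vertexBundle ι x)ᶜ)| ≤ 2 * h := by
    intro x b hx
    have := abs_payment_sub_le hk hb hu out hopt hIC hnorm _ _ (hmem b) hx
    rw [dippedValuation_univ_sub hm hh, card_vertexBundle] at this
    exact_mod_cast this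
  rcases a with x | ⟨x, k⟩
  · have hx := (hopt _ (hmem (.inl x))).bundle_threeValues_empty hu
    exact ⟨hx, hpay x _ hx⟩
  · constructor
    · intro hf
      have hx := bundle_of_edge hΛ hm (hopt _ (hmem (.inr (x, k)))) hf
      have hp := hpay x _ hx
      rw [dip_of_notMem, mul_zero, add_zero] at hp
      · exact ⟨hx, hp⟩
      · rw [compl_vertexBundle_mem_dippedSets]
        exact fun hx' => not_isolatedZero_flipAt k hx' hf
    · intro hf
      have ho := hopt _ (hmem (.inr (x, k)))
      have he : additiveValuation ι Λ (.inr (x, k)) =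
          additiveValuation ι Λ (.inr (flipAt k x, k)) := by
        unfold additiveValuation
        rw [itemValue_flipAt]
      have ho' : (out (additiveValuation ι Λ (.inr (x, k)))).MaximizesWelfare
          ![additiveValuation ι Λ (.inr (flipAt k x, k)), dippedValuation ι Λ ξ] := by
        rw [← he]
        exact ho
      have hx := bundle_of_edge hΛ hm ho' (by rwa [flipAt_flipAt])
      have hp := hpay _ _ hx
      rw [dip_of_notMem, mul_zero, add_zero] at hp
      · exact ⟨hx, hp⟩
      · rw [compl_vertexBundle_mem_dippedSets]
        exact not_isolatedZero_flipAt k hf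

/-! ## The dominant-strategy lower bound -/

/-- The vertices that are an isolated zero of no labelling in `Y`. -/
def neverIsolated (Y : Finset (Vertex h → Fin q)) : Finset (Vertex h) :=
  Finset.univ.filter fun x => ∀ ξ ∈ Y, ¬ IsolatedZero cubeNb ξ x

theorem neverIsolated_anti {Y Y' : Finset (Vertex h → Fin q)} (hY : Y' ⊆ Y) :
    neverIsolated Y ⊆ neverIsolated Y' := by
  intro x hx
  simp only [neverIsolated, Finset.mem_filter, Finset.mem_univ, true_and] at hx ⊢
  exact fun ξ hξ => hx ξ (hY hξ)

/-- The types of the additive player on the lines that avoid the vertices that are never isolated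
zeros. -/
def aliveTypes (Y : Finset (Vertex h → Fin q)) : Set (AdditiveType h) :=
  {a | match a with
    | .inl x => x ∈ clearSet (neverIsolated Y)
    | .inr (x, k) => x ∈ clearSet (neverIsolated Y) ∧ flipAt k x ∈ clearSet (neverIsolated Y)}

theorem aliveTypes_anti (Y Y' : Finset (Vertex h → Fin q)) (hY : Y' ⊆ Y) :
    aliveTypes Y' ⊆ aliveTypes Y := by
  have hsub := clearSet_anti (neverIsolated_anti hY)
  rintro (x | ⟨x, k⟩) ha
  · exact hsub ha
  · exact ⟨hsub ha.1, hsub ha.2⟩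

theorem exists_isolated_of_mem_clearSet {Y : Finset (Vertex h → Fin q)} {x : Vertex h}
    (hx : x ∈ clearSet (neverIsolated Y)) : ∃ ξ ∈ Y, IsolatedZero cubeNb ξ x := by
  have := notMem_of_mem_clearSet hx
  simpa [neverIsolated] using this

theorem profit_lt_of_isPossibleOutcome (hΛ : 2 * (2 * h) < Λ)
    {ξ : Vertex h → Fin q} {v : Finset (Fin m) → ℝ} {o o' : Outcome (Fin 2) (Fin m)}
    {y : Vertex h} (hξ : IsolatedZero cubeNb ξ y)
    (ho : IsPossibleOutcome ι Λ (.inl y) ξ o)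
    (ho' : o'.bundle 0 = vertexBundle ι y ∧ |o'.payment 0 - basePrice h m Λ| ≤ 2 * h) :
    o.profit 0 v < o'.profit 0 v := by
  obtain ⟨h1, h2⟩ := ho
  obtain ⟨h3, h4⟩ := ho'
  rw [dip_of_mem ((compl_vertexBundle_mem_dippedSets ι).mpr hξ), abs_le] at h2
  rw [abs_le] at h4
  have : (2 : ℝ) * (2 * h) < Λ := by exact_mod_cast hΛ
  simp only [Outcome.profit, h1, h3]
  linarith [h2.1, h4.2]

/-- Vertices of the clear set are isolated zeros of some labelling in `Y`. Hence an edge inside it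
has a labelling dipping each endpoint, which ties both vertex types to the edge type;
`eq_of_mem_clearSet` then connects all vertices. -/
theorem eq_of_mem_aliveTypes (hΛ : 2 * (2 * h) < Λ) {Y : Finset (Vertex h → Fin q)}
    (hY : (neverIsolated Y).card < 2 ^ h) {γ : Type} (f : AdditiveType h → γ)
    (hf : ∀ a ∈ aliveTypes Y, ∀ a' ∈ aliveTypes Y, (∃ ξ ∈ Y, ∃ ξ' ∈ Y,
      ∀ o o' : Outcome (Fin 2) (Fin m), IsPossibleOutcome ι Λ a ξ o →
        IsPossibleOutcome ι Λ a' ξ' o' →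
        o.profit 0 (additiveValuation ι Λ a) < o'.profit 0 (additiveValuation ι Λ a)) →
      f a = f a') :
    ∀ a ∈ aliveTypes Y, ∀ a' ∈ aliveTypes Y, f a = f a' := by
  have hedge : ∀ x k, x ∈ clearSet (neverIsolated Y) → flipAt k x ∈ clearSet (neverIsolated Y) →
      f (.inl x) = f (.inr (x, k)) ∧ f (.inl (flipAt k x)) = f (.inr (x, k)) := by
    intro x k hx hxk
    obtain ⟨ξ, hξ, hi⟩ := exists_isolated_of_mem_clearSet hx
    obtain ⟨ξ', hξ', hi'⟩ := exists_isolated_of_mem_clearSet hxk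
    constructor
    · exact hf (.inl x) hx (.inr (x, k)) ⟨hx, hxk⟩ ⟨ξ, hξ, ξ', hξ', fun o o' ho ho' =>
        profit_lt_of_isPossibleOutcome hΛ hi ho (ho'.1 hi')⟩
    · exact hf (.inl (flipAt k x)) hxk (.inr (x, k)) ⟨hx, hxk⟩ ⟨ξ', hξ', ξ, hξ, fun o o' ho ho' =>
        profit_lt_of_isPossibleOutcome hΛ hi' ho (ho'.2 hi)⟩
  have hvert : ∀ x ∈ clearSet (neverIsolated Y), ∀ y ∈ clearSet (neverIsolated Y),
      f (.inl x) = f (.inl y) := fun x hx y hy =>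
    eq_of_mem_clearSet hY (fun x => f (.inl x))
      (fun x k hx hxk => (hedge x k hx hxk).1.trans (hedge x k hx hxk).2.symm) hx hy
  have hred : ∀ a ∈ aliveTypes Y, ∃ x ∈ clearSet (neverIsolated Y), f a = f (.inl x) := by
    rintro (x | ⟨x, k⟩) ha
    · exact ⟨x, ha, rfl⟩
    · exact ⟨x, ha.1, (hedge x k ha.1 ha.2).1.symm⟩
  intro a ha a' ha'
  obtain ⟨x, hx, hax⟩ := hred a ha
  obtain ⟨y, hy, hay⟩ := hred a' ha'
  rw [hax, hay, hvert x hx y hy]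

theorem one_le_two_pow_cost_mul {k : ℕ} (hk : 0 < k) (hh : 0 < h) (hm : 4 * h ≤ m)
    (hΛ : 2 * (2 * h) < Λ) (hb : m * (Λ * (2 * m + 4)) < 2 ^ k) (hq : 2 * (2 * h) ≤ q)
    (P : Mechanism (Fin 2) (Fin m)) (hP : P.IsNormalized)
    (hdom : P.ImplementsInDominantStrategies (gsDomain m k)) (j : ℕ)
    (hj : j * (2 * h + 1) ^ 2 ≤ 2 ^ h) :
    (1 : ℝ) ≤ 2 ^ P.cost * (1 - 1 / (2 * q)) ^ j := by
  obtain ⟨s, hs, hw⟩ := hdom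
  obtain ⟨ι⟩ : Nonempty (Coord h × Bool ↪ Fin m) := by
    refine Function.Embedding.nonempty_of_card_le ?_
    simp
    omega
  have hΛ0 : 0 < Λ := by omega
  have hq1 : (1 : ℝ) ≤ q := by exact_mod_cast Nat.pos_of_ne_zero (NeZero.ne q)
  have hout : ∀ v u, P.outcome s ![v, u] = P.play (Protocol.two (s 0 v) (s 1 u)) := by
    intro v u
    unfold Mechanism.outcome
    congr 1
    funext i
    fin_cases i <;> rfl
  have hdev : ∀ v ∈ gsDomain m k, ∀ p p', (P.play (Protocol.two p p')).profit 0 v ≤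
      (P.play (Protocol.two (s 0 v) p')).profit 0 v := by
    intro v hv p p'
    have := hs 0 v hv (Protocol.two p p')
    have he : Function.update (Protocol.two (T := fun i => P.Plan i) p p') 0 (s 0 v) =
        Protocol.two (s 0 v) p' := by
      funext i
      fin_cases i <;> rfl
    rwa [he] at this
  set B : ℕ := ⌊(1 - 1 / (2 * q) : ℝ) ^ j * Fintype.card (Vertex h → Fin q)⌋₊ with hB
  have hnn : (0 : ℝ) ≤ (1 - 1 / (2 * q) : ℝ) ^ j * Fintype.card (Vertex h → Fin q) := by
    refine mul_nonneg (pow_nonneg ?_ _) (by positivity)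
    rw [sub_nonneg, div_le_one (by linarith)]
    linarith
  have hmain := Protocol.card_le_two_pow_cost_mul (additiveValuation ι Λ) (IsPossibleOutcome ι Λ)
    aliveTypes (fun Y : Finset (Vertex h → Fin q) => 2 ^ h ≤ (neverIsolated Y).card) B
    aliveTypes_anti ?_ ?_ ?_ P (fun a => s 0 (additiveValuation ι Λ a))
    (fun ξ => s 1 (dippedValuation ι Λ ξ)) Finset.univ ?_ ?_
  · have h1 : (Fintype.card (Vertex h → Fin q) : ℝ) ≤ 2 ^ P.cost *
        ((1 - 1 / (2 * q)) ^ j * Fintype.card (Vertex h → Fin q)) := by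
      calc (Fintype.card (Vertex h → Fin q) : ℝ) ≤ 2 ^ P.cost * (B : ℝ) := by
            rw [Finset.card_univ] at hmain
            exact_mod_cast hmain
        _ ≤ _ := by
            gcongr
            exact Nat.floor_le hnn
    have hpos : (0 : ℝ) < Fintype.card (Vertex h → Fin q) := by
      exact_mod_cast Fintype.card_pos
    rw [← mul_assoc] at h1
    by_contra! hlt
    nlinarith
  · intro Y hY
    have h1 := card_no_isolatedZero_le (q := q) card_cubeNb_le notMem_cubeNb cubeNb_symm hq j
      (neverIsolated Y) (hj.trans hY)
    refine Nat.le_floor (le_trans ?_ h1)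
    norm_cast
    refine Finset.card_le_card fun ξ hξ => ?_
    refine Finset.mem_filter.mpr ⟨Finset.mem_univ _, fun x hx => ?_⟩
    exact (Finset.mem_filter.mp hx).2 ξ hξ
  · intro Y hY γ f hf
    exact eq_of_mem_aliveTypes hΛ (not_le.mp hY) f hf
  · intro Y hY hr o
    obtain ⟨x, k, hx, hxk⟩ := exists_flipAt_mem_clearSet (not_le.mp hr) hh
    obtain ⟨ξ, hξ⟩ := hY
    by_contra! hcon
    have h1 := (hcon (.inl x) hx ξ hξ).1
    have h2 := (hcon (.inl (flipAt k x)) hxk ξ hξ).1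
    exact flipAt_ne k x (vertexBundle_injective ι (h2.symm.trans h1))
  · intro a _ p p'
    exact hdev _ (additiveValuation_mem ι Λ hk hb hm a) p p'
  · intro a _ ξ _
    have hu := dippedValuation_mem ι Λ hk hΛ0 hb hm hh ξ
    refine isPossibleOutcome hk hΛ0 hb hm hh ξ
      (fun v => P.play (Protocol.two (s 0 v) (s 1 (dippedValuation ι Λ ξ)))) ?_ ?_ ?_ a
    · intro v hv
      have := hw ![v, dippedValuation ι Λ ξ] (by
        intro i
        fin_cases i
        · exact hv
        · exact hu)
      rwa [hout] at this
    · exact fun v hv w _ => hdev v hv _ _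
    · exact fun v _ => hP _ 0

/-- With `q = 4 * h`, each block of `8 * h` separated vertices contributes a factor `(1 - 1 / (8 *
h)) ^ (8 * h) ≤ exp (-1) ≤ 1 / 2`, that is, one bit of cost. The dip `Λ = m + 1` exceeds the payment
uncertainty `4 * h`. -/
theorem le_cost_of_dominant {k J : ℕ} (hk : 0 < k) (hh : 0 < h) (hm : 4 * h ≤ m)
    (hb : m * ((m + 1) * (2 * m + 4)) < 2 ^ k)
    (P : Mechanism (Fin 2) (Fin m)) (hP : P.IsNormalized)
    (hdom : P.ImplementsInDominantStrategies (gsDomain m k))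
    (hJ : (8 * h) * J * (2 * h + 1) ^ 2 ≤ 2 ^ h) : J ≤ P.cost := by
  have : NeZero (4 * h) := ⟨by omega⟩
  have h1 := one_le_two_pow_cost_mul (q := 4 * h) (Λ := m + 1) hk hh hm (by omega) hb (by omega) P hP
    hdom _ hJ
  have h2 : (1 - 1 / (2 * ((4 * h : ℕ) : ℝ))) ^ (8 * h) ≤ 1 / 2 := by
    have h3 := Real.one_sub_div_pow_le_exp_neg (n := 8 * h) (t := 1) (by
      have : 1 ≤ 8 * h := by omega
      exact_mod_cast this)
    have h4 : (2 : ℝ) ≤ Real.exp 1 := by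
      have := Real.add_one_le_exp 1
      linarith
    have h5 : Real.exp (-1) ≤ 1 / 2 := by
      rw [Real.exp_neg, ← one_div]
      exact one_div_le_one_div_of_le two_pos h4
    have h6 : (2 * ((4 * h : ℕ) : ℝ)) = ((8 * h : ℕ) : ℝ) := by
      push_cast
      ring
    rw [h6]
    exact h3.trans h5
  have hbase : (0 : ℝ) ≤ 1 - 1 / (2 * ((4 * h : ℕ) : ℝ)) := by
    have : (1 : ℝ) ≤ ((4 * h : ℕ) : ℝ) := by
      have : 1 ≤ 4 * h := by omega
      exact_mod_cast this
    rw [sub_nonneg, div_le_one (by linarith)]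
    linarith
  rw [pow_mul] at h1
  have h7 : (1 : ℝ) ≤ 2 ^ P.cost * (1 / 2) ^ J := by
    refine h1.trans ?_
    gcongr
  rw [one_div, inv_pow, ← div_eq_mul_inv, one_le_div (by positivity)] at h7
  exact (pow_le_pow_iff_right₀ one_lt_two).mp h7

end LowerBound

theorem dominant_strategies_lower_bound :
    ∃ (c : ℝ) (K m₀ : ℕ), 0 < c ∧ ∀ m k : ℕ, m₀ ≤ m → K * Nat.clog 2 m ≤ k →
      ∀ P : Mechanism (Fin 2) (Fin m), P.IsNormalized →
        P.ImplementsInDominantStrategies (gsDomain m k) →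
          (2 : ℝ) ^ (c * (m : ℝ)) ≤ (P.cost : ℝ) := by
  -- Take `h = 4 * r` with `r = m / 16`, so that the `4 * h` items of the cube fit, and aim for `J =
  -- 2 ^ (r + 1)`, which is at least `2 ^ (m / 16)` for the real exponent. The threshold `112 = 16 *
  -- 7` gives `r ≥ 7`, the point from which `18 * r ≤ 2 ^ r` absorbs the polynomial factors.
  refine ⟨1 / 16, 7, 112, by norm_num, fun m k hm hk P hP hdom => ?_⟩
  obtain ⟨r, hr⟩ : ∃ r, r = m / 16 := ⟨_, rfl⟩
  have hr7 : 7 ≤ r := by omega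
  have h18 : 18 * r ≤ 2 ^ r := by
    clear hr
    induction r, hr7 using Nat.le_induction with
    | base => norm_num
    | succ r h7 ih => rw [pow_succ]; omega
  have hmk : m ^ 7 ≤ 2 ^ k := by
    calc m ^ 7 ≤ (2 ^ Nat.clog 2 m) ^ 7 := Nat.pow_le_pow_left (Nat.le_pow_clog one_lt_two m) 7
      _ = 2 ^ (7 * Nat.clog 2 m) := by rw [← pow_mul, mul_comm]
      _ ≤ 2 ^ k := Nat.pow_le_pow_right two_pos hk
  have hb : m * ((m + 1) * (2 * m + 4)) < 2 ^ k := by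
    refine lt_of_lt_of_le ?_ hmk
    calc m * ((m + 1) * (2 * m + 4)) ≤ m * ((2 * m) * (4 * m)) := by gcongr <;> omega
      _ = 8 * m ^ 3 := by ring
      _ < m ^ 4 * m ^ 3 := by
          have : 8 < m ^ 4 := lt_of_lt_of_le (by norm_num) (Nat.pow_le_pow_left hm 4)
          exact Nat.mul_lt_mul_of_pos_right this (by positivity)
      _ = m ^ 7 := by ring
  have hk0 : 0 < k := by
    have : 0 < Nat.clog 2 m := Nat.clog_pos one_lt_two (by omega)
    omega
  have hJ : (8 * (4 * r)) * 2 ^ (r + 1) * (2 * (4 * r) + 1) ^ 2 ≤ 2 ^ (4 * r) := by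
    calc (8 * (4 * r)) * 2 ^ (r + 1) * (2 * (4 * r) + 1) ^ 2
        ≤ (8 * (4 * r)) * 2 ^ (r + 1) * (9 * r) ^ 2 := by gcongr; omega
      _ ≤ 2 ^ r * (18 * r) ^ 3 := by ring_nf; gcongr; norm_num
      _ ≤ 2 ^ r * (2 ^ r) ^ 3 := by gcongr
      _ = 2 ^ (4 * r) := by rw [← pow_mul, ← pow_add]; congr 1; ring
  have hcost := le_cost_of_dominant (h := 4 * r) hk0 (by omega) (by omega) hb P hP hdom hJ
  calc (2 : ℝ) ^ (1 / 16 * (m : ℝ)) ≤ (2 : ℝ) ^ ((r + 1 : ℕ) : ℝ) := by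
        refine Real.rpow_le_rpow_of_exponent_le one_le_two ?_
        have : m ≤ 16 * (r + 1) := by omega
        have : (m : ℝ) ≤ 16 * ((r + 1 : ℕ) : ℝ) := by exact_mod_cast this
        linarith
    _ = ((2 ^ (r + 1) : ℕ) : ℝ) := by rw [Real.rpow_natCast]; norm_cast
    _ ≤ P.cost := by exact_mod_cast hcost

/-! ## Computing relations by two-player protocols -/

section Achieves

variable {V O : Type}

/-- Some protocol with cost at most `c` and leaf labels in `N` finds, on all inputs in `R`, a label
related to the inputs by `Φ`. -/
def Achieves (N : O → Prop) (Φ : V → V → O → Prop) (R : Set (V × V)) (c : ℕ) : Prop :=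
  ∃ P : Protocol (Fin 2) O, ∃ s : ∀ i, V → P.Plan i, P.cost ≤ c ∧ (∀ b, N (P.play b)) ∧
    ∀ x y, (x, y) ∈ R → Φ x y (P.play (Protocol.two (s 0 x) (s 1 y)))

variable {N : O → Prop} {Φ : V → V → O → Prop} {R R' : Set (V × V)} {c c' : ℕ}

theorem Achieves.mono (h : Achieves N Φ R c) (hR : R' ⊆ R) (hc : c ≤ c') :
    Achieves N Φ R' c' := by
  obtain ⟨P, s, h1, h2, h3⟩ := h
  exact ⟨P, s, h1.trans hc, h2, fun x y hxy => h3 x y (hR hxy)⟩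

theorem achieves_leaf (o : O) (ho : N o) (h : ∀ x y, (x, y) ∈ R → Φ x y o) :
    Achieves N Φ R 0 :=
  ⟨.leaf o, fun _ _ => (), le_rfl, fun _ => ho, h⟩

theorem achieves_node {k : Fin 2 → ℕ} (f₀ : V → Fin (k 0 + 1)) (f₁ : V → Fin (k 1 + 1))
    (h : ∀ z₀ z₁, Achieves N Φ {p | p ∈ R ∧ f₀ p.1 = z₀ ∧ f₁ p.2 = z₁} c) :
    Achieves N Φ R (Nat.clog 2 (k 0 + 1) + Nat.clog 2 (k 1 + 1) + c) := by
  choose P s h1 h2 h3 using h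
  refine ⟨.node k fun z => P (z 0) (z 1), Protocol.two (fun x => (f₀ x, fun z => s (z 0) (z 1) 0 x))
    (fun y => (f₁ y, fun z => s (z 0) (z 1) 1 y)), ?_, fun b => h2 _ _ _, fun x y hxy => ?_⟩
  · simp only [Protocol.cost, Fin.sum_univ_two]
    gcongr
    exact Finset.sup_le fun z _ => h1 _ _
  · exact Protocol.play_node_two (next := fun z => P (z 0) (z 1))
      (f₀ x, fun z => s (z 0) (z 1) 0 x) (f₁ y, fun z => s (z 0) (z 1) 1 y) ▸
      h3 (f₀ x) (f₁ y) x y ⟨hxy, rfl, rfl⟩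

theorem achieves_messages {A B : Type} [Fintype A] [Fintype B] [Nonempty A] [Nonempty B]
    (f₀ : V → A) (f₁ : V → B) {e₀ e₁ : ℕ} (hA : Fintype.card A ≤ 2 ^ e₀)
    (hB : Fintype.card B ≤ 2 ^ e₁)
    (h : ∀ a b, Achieves N Φ {p | p ∈ R ∧ f₀ p.1 = a ∧ f₁ p.2 = b} c) :
    Achieves N Φ R (e₀ + e₁ + c) := by
  obtain ⟨k₀, hk₀⟩ := Nat.exists_eq_succ_of_ne_zero (Fintype.card_ne_zero (α := A))
  obtain ⟨k₁, hk₁⟩ := Nat.exists_eq_succ_of_ne_zero (Fintype.card_ne_zero (α := B))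
  let g₀ : A ≃ Fin (k₀ + 1) := Fintype.equivFinOfCardEq hk₀
  let g₁ : B ≃ Fin (k₁ + 1) := Fintype.equivFinOfCardEq hk₁
  have := achieves_node (N := N) (Φ := Φ) (R := R) (c := c) (k := ![k₀, k₁])
    (fun x => g₀ (f₀ x)) (fun y => g₁ (f₁ y)) (fun z₀ z₁ => by
      refine (h (g₀.symm z₀) (g₁.symm z₁)).mono ?_ le_rfl
      rintro p ⟨hp, rfl, rfl⟩
      exact ⟨hp, by simp, by simp⟩)
  refine this.mono le_rfl ?_
  have h0 : Nat.clog 2 (k₀ + 1) ≤ e₀ := Nat.clog_le_of_le_pow (by omega)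
  have h1 : Nat.clog 2 (k₁ + 1) ≤ e₁ := Nat.clog_le_of_le_pow (by omega)
  simp only [Matrix.cons_val_zero, Matrix.cons_val_one]
  omega

/-! ## Deciding a property with two monochromatic covers -/

variable {C : Type} [Fintype C] [DecidableEq C]

/-- The inputs in `R` that lie in some rectangle `R₀ c ×ˢ R₁ c` with `c ∈ A`. -/
def coveredBy (R₀ R₁ : C → Set V) (R : Set (V × V)) (A : Finset C) : Set (V × V) :=
  {p | p ∈ R ∧ ∃ a ∈ A, p.1 ∈ R₀ a ∧ p.2 ∈ R₁ a}

/-- Halving the candidates in `B`: a rectangle of `A` meets each rectangle of `B` in at most one of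
the two directions, so in one direction it meets fewer than half of the bound `2 ^ (n + 1)`. A
player who knows such an `a` on his side announces it, and only the rectangles of `B` meeting it
there survive. Each of the `n` rounds costs `2 * e` bits. -/
theorem achieves_of_cover (R₀ R₁ : C → Set V) (R : Set (V × V)) (A : Finset C) {e : ℕ}
    (he : Fintype.card C + 1 ≤ 2 ^ e) (n : ℕ) : ∀ (B : Finset C) (Q : Set (V × V)),
      B.card < 2 ^ n → Q ⊆ R →
      (∀ a ∈ A, ∀ b ∈ B, Disjoint (R₀ a) (R₀ b) ∨ Disjoint (R₁ a) (R₁ b)) →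
      Q ⊆ coveredBy R₀ R₁ R A ∪ coveredBy R₀ R₁ R B →
      Achieves N Φ (coveredBy R₀ R₁ R A) c → Achieves N Φ (coveredBy R₀ R₁ R B) c →
      Achieves N Φ Q (n * (2 * e) + c) := by
  classical
  induction n with
  | zero =>
    intro B Q hB hQ _ hcov hA _
    have hB0 : B = ∅ := by
      rw [← Finset.card_eq_zero]
      simpa using hB
    subst hB0
    refine hA.mono (fun p hp => ?_) (by simp)
    rcases hcov hp with h | ⟨-, b, hb, -⟩
    · exact h
    · simp at hb
  | succ n ih =>
    intro B Q hB hQ hdis hcov hA hBc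
    set B₀ : C → Finset C := fun a => B.filter fun b => ¬ Disjoint (R₀ a) (R₀ b) with hB₀
    set B₁ : C → Finset C := fun a => B.filter fun b => ¬ Disjoint (R₁ a) (R₁ b) with hB₁
    have hsum : ∀ a ∈ A, (B₀ a).card + (B₁ a).card ≤ B.card := by
      intro a ha
      rw [← Finset.card_union_of_disjoint]
      · exact Finset.card_le_card (Finset.union_subset (Finset.filter_subset _ _)
          (Finset.filter_subset _ _))
      · refine Finset.disjoint_left.mpr fun b hb hb' => ?_
        rw [Finset.mem_filter] at hb hb'
        rcases hdis a ha b hb.1 with h | h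
        · exact hb.2 h
        · exact hb'.2 h
    have hpick : ∀ (S : C → Set V) (D : C → Finset C), ∃ f : V → Option C,
        (∀ x a, f x = some a → a ∈ A ∧ (D a).card < 2 ^ n ∧ x ∈ S a) ∧
        (∀ x, f x = none → ∀ a ∈ A, (D a).card < 2 ^ n → x ∉ S a) := by
      intro S D
      refine ⟨fun x => if h : ∃ a, a ∈ A ∧ (D a).card < 2 ^ n ∧ x ∈ S a then some h.choose
        else none, fun x a hx => ?_, fun x hx a ha hD hS => ?_⟩
      · beta_reduce at hx
        split_ifs at hx with h
        rw [Option.some.injEq] at hx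
        rw [← hx]
        exact h.choose_spec
      · beta_reduce at hx
        split_ifs at hx with h
        exact h ⟨a, ha, hD, hS⟩
    obtain ⟨f₀, hs₀, hn₀⟩ := hpick R₀ B₀
    obtain ⟨f₁, hs₁, hn₁⟩ := hpick R₁ B₁
    have hcard : Fintype.card (Option C) ≤ 2 ^ e := by rwa [Fintype.card_option]
    have hsubB : ∀ B' ⊆ B, Achieves N Φ (coveredBy R₀ R₁ R B') c := fun B' hB' =>
      hBc.mono (fun p hp => ⟨hp.1, hp.2.imp fun b hb => ⟨hB' hb.1, hb.2⟩⟩) le_rfl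
    have hstep : ∀ o₀ o₁, Achieves N Φ {p | p ∈ Q ∧ f₀ p.1 = o₀ ∧ f₁ p.2 = o₁}
        (n * (2 * e) + c) := by
      intro o₀ o₁
      rcases o₀ with _ | a
      · rcases o₁ with _ | a
        -- Neither player has a useful rectangle, so no rectangle of `A` contains the input and it
        -- is covered by `B`.
        · refine hBc.mono ?_ (Nat.le_add_left _ _)
          rintro p ⟨hp, h0, h1⟩
          rcases hcov hp with ⟨-, a, ha, hpa⟩ | h
          · exfalso
            have := hsum a ha
            rw [pow_succ] at hB
            rcases Nat.lt_or_ge (B₀ a).card (2 ^ n) with h | h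
            · exact hn₀ _ h0 a ha h hpa.1
            · exact hn₁ _ h1 a ha (by omega) hpa.2
          · exact h
        · by_cases hne : ∃ y, f₁ y = some a
          · obtain ⟨y, hy⟩ := hne
            refine ih (B₁ a) _ (hs₁ y a hy).2.1 (fun p hp => hQ hp.1)
              (fun a' ha' b hb => hdis a' ha' b (Finset.filter_subset _ _ hb)) ?_ hA
              (hsubB _ (Finset.filter_subset _ _))
            rintro p ⟨hp, -, h1⟩
            rcases hcov hp with h | ⟨hR, b, hb, hpb⟩
            · exact Or.inl h
            · refine Or.inr ⟨hR, b, Finset.mem_filter.mpr ⟨hb, ?_⟩, hpb⟩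
              exact Set.not_disjoint_iff.mpr ⟨p.2, (hs₁ _ _ h1).2.2, hpb.2⟩
          · exact hA.mono (fun p hp => absurd ⟨p.2, hp.2.2⟩ hne) (Nat.le_add_left _ _)
      · by_cases hne : ∃ y, f₀ y = some a
        · obtain ⟨y, hy⟩ := hne
          refine ih (B₀ a) _ (hs₀ y a hy).2.1 (fun p hp => hQ hp.1)
            (fun a' ha' b hb => hdis a' ha' b (Finset.filter_subset _ _ hb)) ?_ hA
            (hsubB _ (Finset.filter_subset _ _))
          rintro p ⟨hp, h0, -⟩
          rcases hcov hp with h | ⟨hR, b, hb, hpb⟩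
          · exact Or.inl h
          · refine Or.inr ⟨hR, b, Finset.mem_filter.mpr ⟨hb, ?_⟩, hpb⟩
            exact Set.not_disjoint_iff.mpr ⟨p.1, (hs₀ _ _ h0).2.2, hpb.1⟩
        · exact hA.mono (fun p hp => absurd ⟨p.1, hp.2.1⟩ hne) (Nat.le_add_left _ _)
    refine (achieves_messages f₀ f₁ hcard hcard hstep).mono le_rfl (le_of_eq ?_)
    ring

/-- A protocol that finds the colour of a monochromatic cover by rectangles, where the colours are
sets of items. -/
theorem achieves_of_colour {I : Type} [DecidableEq I] (R₀ R₁ : C → Set V) (R : Set (V × V))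
    (colour : C → Finset I) (answer : V × V → Finset I) {e : ℕ}
    (he : Fintype.card C + 1 ≤ 2 ^ e)
    (hdis : ∀ a b, colour a ≠ colour b → Disjoint (R₀ a) (R₀ b) ∨ Disjoint (R₁ a) (R₁ b))
    (hcov : ∀ p ∈ R, ∃ a, p.1 ∈ R₀ a ∧ p.2 ∈ R₁ a)
    (hcol : ∀ p ∈ R, ∀ a, p.1 ∈ R₀ a → p.2 ∈ R₁ a → colour a = answer p)
    (hfin : ∀ T, Achieves N Φ {p | p ∈ R ∧ answer p = T} c) (J : Finset I) :
    ∀ T : Finset I, Achieves N Φ {p | p ∈ R ∧ ∀ i : I, i ∉ J → (i ∈ answer p ↔ i ∈ T)}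
      (J.card * (e * (2 * e)) + c) := by
  classical
  induction J using Finset.induction_on with
  | empty =>
    intro T
    refine (hfin T).mono ?_ (by simp)
    rintro p ⟨hp, h⟩
    exact ⟨hp, Finset.ext fun i => h i (by simp)⟩
  | insert j J hj ih =>
    intro T
    set Q := {p | p ∈ R ∧ ∀ i : I, i ∉ insert j J → (i ∈ answer p ↔ i ∈ T)} with hQ
    have hQR : Q ⊆ R := fun p hp => hp.1
    -- Decide whether `j` belongs to the answer by splitting the rectangles according to whether
    -- their colour contains `j`. There are fewer than `2 ^ e` rectangles, so `e` rounds suffice.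
    have := achieves_of_cover (N := N) (Φ := Φ) (c := J.card * (e * (2 * e)) + c) R₀ R₁ Q
      (Finset.univ.filter fun a => j ∉ colour a) he e
      (Finset.univ.filter fun a => j ∈ colour a) Q ?_ le_rfl ?_ ?_ ?_ ?_
    · refine this.mono le_rfl (le_of_eq ?_)
      rw [Finset.card_insert_of_notMem hj]
      ring
    · exact lt_of_lt_of_le (Nat.lt_succ_of_le (Finset.card_le_univ _)) he
    · intro a ha b hb
      simp only [Finset.mem_filter, Finset.mem_univ, true_and] at ha hb
      refine hdis a b fun hab => ha ?_
      rwa [hab]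
    · intro p hp
      obtain ⟨a, ha⟩ := hcov p (hQR hp)
      by_cases hja : j ∈ colour a
      · exact Or.inr ⟨hp, a, by simpa using hja, ha⟩
      · exact Or.inl ⟨hp, a, by simpa using hja, ha⟩
    · refine (ih (T.erase j)).mono ?_ le_rfl
      rintro p ⟨hp, a, ha, ha0, ha1⟩
      refine ⟨hp.1, fun i hi => ?_⟩
      have hc := hcol p hp.1 a ha0 ha1
      simp only [Finset.mem_filter, Finset.mem_univ, true_and, hc] at ha
      by_cases hij : i = j
      · subst hij
        simp [ha]
      · rw [hp.2 i (by simp [hij, hi])]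
        simp [hij]
    · refine (ih (insert j T)).mono ?_ le_rfl
      rintro p ⟨hp, a, ha, ha0, ha1⟩
      refine ⟨hp.1, fun i hi => ?_⟩
      have hc := hcol p hp.1 a ha0 ha1
      simp only [Finset.mem_filter, Finset.mem_univ, true_and, hc] at ha
      by_cases hij : i = j
      · subst hij
        simp [ha]
      · rw [hp.2 i (by simp [hij, hi])]
        simp [hij]

end Achieves

/-! ## The ascending auction of Kelso and Crawford -/

section Auction

variable {M : Type} [Fintype M] [DecidableEq M] {v : Fin 2 → Finset M → ℝ} {δ b : ℝ}

/-- The prices faced by a player who holds the items of `A`: the items of the other player and the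
unsold items cost `δ` more than the current price. -/
noncomputable def askPrice (δ : ℝ) (q : M → ℕ) (A : Finset M) (j : M) : ℝ :=
  δ * (q j + if j ∈ A then 0 else 1)

/-- The invariants of the auction: prices are bounded, unsold items are free, and every player
holds a part of a bundle that he demands. -/
structure IsAuctionState (v : Fin 2 → Finset M → ℝ) (δ b : ℝ) (q : M → ℕ)
    (S : Fin 2 → Finset M) : Prop where
  disjoint : Disjoint (S 0) (S 1)
  bound : ∀ j, δ * q j ≤ b
  unsold : ∀ j, (∀ i, j ∉ S i) → q j = 0
  demand : ∀ i, ∃ D ∈ demandSet (v i) (askPrice δ q (S i)), S i ⊆ D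

/-- Player `i` takes a demanded bundle `D ⊇ S i`, and the items new to him rise by `δ`. His own ask
prices do not change, so `D` stays demanded. The other player's ask prices only rise, and not on the
items he keeps, so gross substitutes extends these to a demanded bundle. A newly taken item is worth
its new price, hence the bound `b`; an item once held is never released. -/
theorem IsAuctionState.step (hv : ∀ i, IsGrossSubstitutes (v i)) (hδ : 0 < δ)
    (hb : ∀ i S, ∀ j ∈ S, v i S - v i (S.erase j) ≤ b) {q : M → ℕ} {S : Fin 2 → Finset M}
    (h : IsAuctionState v δ b q S) {i : Fin 2}
    (hi : S i ∉ demandSet (v i) (askPrice δ q (S i))) :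
    ∃ q' S', IsAuctionState v δ b q' S' ∧ ∑ j, q j < ∑ j, q' j := by
  obtain ⟨D, hD, hSD⟩ := h.demand i
  have hne : ∃ j ∈ D, j ∉ S i := by
    by_contra! hcon
    exact hi (hSD.antisymm hcon ▸ hD)
  let q' : M → ℕ := fun j => if j ∈ D ∧ j ∉ S i then q j + 1 else q j
  let S' : Fin 2 → Finset M := Function.update (fun o => S o \ D) i D
  have hS'i : S' i = D := by simp [S']
  have hS'o : ∀ o, o ≠ i → S' o = S o \ D := fun o ho => by simp [S', ho]
  have hqle : ∀ j, q j ≤ q' j := by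
    intro j
    simp only [q']
    split_ifs <;> omega
  have hask : askPrice δ q' D = askPrice δ q (S i) := by
    funext j
    have := @hSD j
    unfold askPrice
    by_cases h1 : j ∈ D <;> by_cases h2 : j ∈ S i <;> simp [q', h1, h2]
    exact absurd (this h2) h1
  refine ⟨q', S', ⟨?_, ?_, ?_, ?_⟩, ?_⟩
  · have hd : ∀ o, o ≠ i → Disjoint D (S o \ D) := fun o _ => Finset.disjoint_sdiff
    fin_cases i
    · exact (hS'i.symm ▸ hS'o 1 (by decide) ▸ hd 1 (by decide) : Disjoint (S' 0) (S' 1))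
    · exact (hS'i.symm ▸ hS'o 0 (by decide) ▸ hd 0 (by decide) : Disjoint (S' 1) (S' 0)).symm
  · intro j
    by_cases hj : j ∈ D ∧ j ∉ S i
    · have h1 := hD (D.erase j)
      rw [← Finset.sum_erase_add D _ hj.1] at h1
      have h2 := hb i D j hj.1
      have h3 : askPrice δ q (S i) j = δ * q' j := by
        simp [askPrice, q', hj]
      linarith
    · simpa [q', hj] using h.bound j
  · intro j hj
    have h1 := hj i
    rw [hS'i] at h1
    have : q' j = q j := by simp [q', h1]
    rw [this]
    refine h.unsold j fun o ho => ?_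
    by_cases hoi : o = i
    · subst hoi
      exact h1 (hSD ho)
    · have := hj o
      rw [hS'o o hoi] at this
      exact this (Finset.mem_sdiff.mpr ⟨ho, h1⟩)
  · intro o
    by_cases hoi : o = i
    · subst hoi
      rw [hS'i]
      exact ⟨D, by rwa [hask], subset_rfl⟩
    · rw [hS'o o hoi]
      obtain ⟨E, hE, hSE⟩ := h.demand o
      have hle : askPrice δ q (S o) ≤ askPrice δ q' (S o \ D) := by
        intro j
        refine mul_le_mul_of_nonneg_left (add_le_add (Nat.cast_le.mpr (hqle j)) ?_) hδ.le
        by_cases h1 : j ∈ S o <;> by_cases h2 : j ∈ D <;> simp [h1, h2]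
      obtain ⟨E', hE', hsub⟩ := hv o _ _ hle E hE
      refine ⟨E', hE', fun j hj => hsub j (hSE (Finset.mem_sdiff.mp hj).1) ?_⟩
      have hj' := Finset.mem_sdiff.mp hj
      simp [askPrice, q', hj'.1, hj'.2]
  · obtain ⟨j, hjD, hjS⟩ := hne
    refine Finset.sum_lt_sum (fun j _ => hqle j) ⟨j, Finset.mem_univ j, ?_⟩
    simp [q', hjD, hjS]

/-- Prices are bounded and some price rises in every step, so the auction stops. Ask prices exceed
the final prices by at most `δ` per item, which is the error term. -/
theorem exists_approximate_equilibrium (hv : ∀ i, IsGrossSubstitutes (v i)) (hδ : 0 < δ)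
    (hb0 : 0 ≤ b) (hb : ∀ i S, ∀ j ∈ S, v i S - v i (S.erase j) ≤ b) :
    ∃ (q : M → ℕ) (S : Fin 2 → Finset M), Disjoint (S 0) (S 1) ∧ (∀ j, δ * q j ≤ b) ∧
      (∀ j, (∀ i, j ∉ S i) → q j = 0) ∧ ∀ i T, v i T - ∑ j ∈ T, δ * q j ≤
        v i (S i) - ∑ j ∈ S i, δ * q j + Fintype.card M * δ := by
  have hterm : ∃ q S, IsAuctionState v δ b q S ∧
      ∀ i, S i ∈ demandSet (v i) (askPrice δ q (S i)) := by
    by_contra! hcon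
    have hgrow : ∀ n : ℕ, ∃ q S, IsAuctionState v δ b q S ∧ n ≤ ∑ j, q j := by
      intro n
      induction n with
      | zero =>
        refine ⟨fun _ => 0, fun _ => ∅,
          ⟨by simp, fun _ => by simpa using hb0, fun _ _ => rfl, fun i => ?_⟩,
          Nat.zero_le _⟩
        obtain ⟨D, hD⟩ := demandSet_nonempty (v i) (askPrice δ (fun _ => 0) ∅)
        exact ⟨D, hD, Finset.empty_subset _⟩
      | succ n ih =>
        obtain ⟨q, S, hS, hn⟩ := ih
        obtain ⟨i, hi⟩ := hcon q S hS
        obtain ⟨q', S', hS', hlt⟩ := hS.step hv hδ hb hi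
        exact ⟨q', S', hS', by omega⟩
    obtain ⟨q, S, hS, hn⟩ := hgrow (Fintype.card M * ⌊b / δ⌋₊ + 1)
    have : ∑ j, q j ≤ Fintype.card M * ⌊b / δ⌋₊ := by
      calc ∑ j, q j ≤ ∑ _j : M, ⌊b / δ⌋₊ := by
            refine Finset.sum_le_sum fun j _ => Nat.le_floor ?_
            rw [le_div_iff₀ hδ, mul_comm]
            exact hS.bound j
        _ = _ := by simp
    omega
  obtain ⟨q, S, hS, hd⟩ := hterm
  refine ⟨q, S, hS.disjoint, hS.bound, hS.unsold, fun i T => ?_⟩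
  have h1 := hd i T
  have h2 : ∑ j ∈ S i, askPrice δ q (S i) j = ∑ j ∈ S i, δ * q j :=
    Finset.sum_congr rfl fun j hj => by simp [askPrice, hj]
  have h3 : ∑ j ∈ T, askPrice δ q (S i) j ≤ ∑ j ∈ T, δ * q j + Fintype.card M * δ := by
    calc ∑ j ∈ T, askPrice δ q (S i) j ≤ ∑ j ∈ T, (δ * q j + δ) := by
          refine Finset.sum_le_sum fun j _ => ?_
          unfold askPrice
          split_ifs <;> nlinarith
      _ = ∑ j ∈ T, δ * q j + T.card * δ := by simp [Finset.sum_add_distrib]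
      _ ≤ _ := by
          gcongr
          exact Finset.card_le_univ T
  rw [h2] at h1
  linarith

end Auction

/-! ## Breaking ties between welfare-maximizing allocations -/

section ExPost

variable {m k : ℕ}

/-- The weights that break ties. -/
noncomputable def tieWeight (m k : ℕ) (j : Fin m) : ℝ := 2 ^ (j : ℕ) / 2 ^ (4 * k + m + 1)

/-- The valuation `x` with the tie-breaking weights added. -/
noncomputable def perturbed (k : ℕ) (x : Finset (Fin m) → ℝ) (S : Finset (Fin m)) : ℝ :=
  x S + additive (tieWeight m k) S

/-- The perturbed welfare of the allocation of `S` to the first and `Sᶜ` to the second player. -/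
noncomputable def perturbedWelfare (k : ℕ) (x y : Finset (Fin m) → ℝ) (S : Finset (Fin m)) : ℝ :=
  perturbed k x S + y Sᶜ

theorem additive_tieWeight (S : Finset (Fin m)) :
    additive (tieWeight m k) S = ((∑ j ∈ S, 2 ^ (j : ℕ) : ℕ) : ℝ) / 2 ^ (4 * k + m + 1) := by
  simp [additive, tieWeight, Finset.sum_div]

theorem sum_two_pow_fin_lt (S : Finset (Fin m)) : ∑ j ∈ S, 2 ^ (j : ℕ) < 2 ^ m := by
  calc ∑ j ∈ S, 2 ^ (j : ℕ) ≤ ∑ j : Fin m, 2 ^ (j : ℕ) :=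
        Finset.sum_le_sum_of_subset (Finset.subset_univ S)
    _ = ∑ j ∈ Finset.range m, 2 ^ j := Fin.sum_univ_eq_sum_range (fun j => 2 ^ j) m
    _ < 2 ^ m := Nat.geomSum_lt le_rfl (by simp)

theorem sum_two_pow_fin_injective {S T : Finset (Fin m)}
    (h : ∑ j ∈ S, 2 ^ (j : ℕ) = ∑ j ∈ T, 2 ^ (j : ℕ)) : S = T := by
  apply Finset.map_injective Fin.valEmbedding
  apply Finset.geomSum_injective (le_refl 2)
  simpa using h

theorem one_div_le_abs_sub {x y : Finset (Fin m) → ℝ} (hx : HasBitValues k x)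
    (hy : HasBitValues k y) {A B A' B' : Finset (Fin m)} (hlt : x A + y B < x A' + y B') :
    1 / 2 ^ (4 * k) ≤ x A' + y B' - (x A + y B) := by
  obtain ⟨a₁, b₁, -, h₁, h₁', e₁⟩ := hx A
  obtain ⟨a₂, b₂, -, h₂, h₂', e₂⟩ := hy B
  obtain ⟨a₃, b₃, -, h₃, h₃', e₃⟩ := hx A'
  obtain ⟨a₄, b₄, -, h₄, h₄', e₄⟩ := hy B'
  rw [e₁, e₂, e₃, e₄] at hlt
  rw [e₃, e₄, e₁, e₂]
  have p₁ : (0 : ℝ) < b₁ := by exact_mod_cast h₁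
  have p₂ : (0 : ℝ) < b₂ := by exact_mod_cast h₂
  have p₃ : (0 : ℝ) < b₃ := by exact_mod_cast h₃
  have p₄ : (0 : ℝ) < b₄ := by exact_mod_cast h₄
  set N : ℤ := (a₃ * b₄ + a₄ * b₃) * (b₁ * b₂) - (a₁ * b₂ + a₂ * b₁) * (b₃ * b₄) with hN
  have hd : (a₃ : ℝ) / b₃ + a₄ / b₄ - (a₁ / b₁ + a₂ / b₂) = N / (b₁ * b₂ * b₃ * b₄) := by
    rw [hN]
    push_cast
    field_simp
  have hpos : (0 : ℝ) < N / (b₁ * b₂ * b₃ * b₄) := by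
    rw [← hd]
    linarith
  have hN1 : (1 : ℝ) ≤ N := by
    have : (0 : ℝ) < N := by
      by_contra! hcon
      exact absurd hpos (not_lt.mpr (div_nonpos_of_nonpos_of_nonneg hcon (by positivity)))
    have : 0 < N := by exact_mod_cast this
    exact_mod_cast this
  have hden : (b₁ : ℝ) * b₂ * b₃ * b₄ ≤ 2 ^ (4 * k) := by
    have : b₁ * b₂ * b₃ * b₄ ≤ 2 ^ k * 2 ^ k * 2 ^ k * 2 ^ k := by gcongr
    have h2 : 2 ^ k * 2 ^ k * 2 ^ k * 2 ^ k = 2 ^ (4 * k) := by ring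
    rw [h2] at this
    exact_mod_cast this
  rw [hd]
  exact div_le_div₀ (by linarith) hN1 (by positivity) hden

theorem tieWeight_lt (S : Finset (Fin m)) :
    0 ≤ additive (tieWeight m k) S ∧
      additive (tieWeight m k) S ≤ 1 / 2 ^ (4 * k) / 2 - 1 / 2 ^ (4 * k + m + 1) := by
  rw [additive_tieWeight]
  refine ⟨by positivity, ?_⟩
  have h : ((∑ j ∈ S, 2 ^ (j : ℕ) : ℕ) : ℝ) + 1 ≤ 2 ^ m := by exact_mod_cast sum_two_pow_fin_lt S
  have e : (1 : ℝ) / 2 ^ (4 * k) / 2 = 2 ^ m / 2 ^ (4 * k + m + 1) := by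
    rw [pow_add, pow_add]
    field_simp
  rw [e, ← sub_div]
  gcongr
  linarith

theorem perturbedWelfare_gap_of_lt {x y : Finset (Fin m) → ℝ} (hx : HasBitValues k x)
    (hy : HasBitValues k y) {S T : Finset (Fin m)} (hlt : x T + y Tᶜ < x S + y Sᶜ) :
    perturbedWelfare k x y T + 1 / 2 ^ (4 * k + m + 1) ≤ perturbedWelfare k x y S := by
  have h1 := one_div_le_abs_sub hx hy hlt
  have h2 := tieWeight_lt (k := k) S
  have h3 := tieWeight_lt (k := k) T
  unfold perturbedWelfare perturbed
  have : (0 : ℝ) < 1 / 2 ^ (4 * k) := by positivity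
  linarith [h2.1, h3.2]

/-- Unequal true welfares differ by at least `1 / 2 ^ (4 * k)`, since four `k`-bit denominators are
involved, and all tie-breaking weights together stay below half of that. Among equal true welfares,
uniqueness of binary expansions separates the weights by one unit. -/
theorem perturbedWelfare_gap {x y : Finset (Fin m) → ℝ} (hx : HasBitValues k x)
    (hy : HasBitValues k y) {S T : Finset (Fin m)} (hST : S ≠ T)
    (hle : perturbedWelfare k x y T ≤ perturbedWelfare k x y S) :
    perturbedWelfare k x y T + 1 / 2 ^ (4 * k + m + 1) ≤ perturbedWelfare k x y S := by
  have hpos : (0 : ℝ) < 1 / 2 ^ (4 * k + m + 1) := by positivity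
  rcases lt_trichotomy (x T + y Tᶜ) (x S + y Sᶜ) with h | h | h
  · exact perturbedWelfare_gap_of_lt hx hy h
  · unfold perturbedWelfare perturbed at hle ⊢
    have hle' : additive (tieWeight m k) T ≤ additive (tieWeight m k) S := by linarith
    suffices additive (tieWeight m k) T + 1 / 2 ^ (4 * k + m + 1) ≤
        additive (tieWeight m k) S by linarith
    rw [additive_tieWeight, additive_tieWeight] at hle' ⊢
    rw [div_le_div_iff_of_pos_right (by positivity)] at hle'
    rw [← add_div]
    gcongr
    have h1 : ∑ j ∈ T, 2 ^ (j : ℕ) ≤ ∑ j ∈ S, 2 ^ (j : ℕ) := by exact_mod_cast hle'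
    have h2 : ∑ j ∈ T, 2 ^ (j : ℕ) ≠ ∑ j ∈ S, 2 ^ (j : ℕ) := fun he =>
      hST (sum_two_pow_fin_injective he).symm
    exact_mod_cast Nat.succ_le_of_lt (lt_of_le_of_ne h1 h2)
  · have := perturbedWelfare_gap_of_lt hx hy h
    linarith

theorem exists_optimal (k : ℕ) (x y : Finset (Fin m) → ℝ) :
    ∃ S, ∀ T, perturbedWelfare k x y T ≤ perturbedWelfare k x y S :=
  Finite.exists_max _

/-- The bundle of the first player in the allocation that maximizes the perturbed welfare. -/
noncomputable def optimalBundle (k : ℕ) (p : (Finset (Fin m) → ℝ) × (Finset (Fin m) → ℝ)) :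
    Finset (Fin m) :=
  (exists_optimal k p.1 p.2).choose

theorem le_perturbedWelfare_optimalBundle (x y : Finset (Fin m) → ℝ) (T : Finset (Fin m)) :
    perturbedWelfare k x y T ≤ perturbedWelfare k x y (optimalBundle k (x, y)) :=
  (exists_optimal k x y).choose_spec T

theorem le_welfare_optimalBundle {x y : Finset (Fin m) → ℝ} (hx : x ∈ gsDomain m k)
    (hy : y ∈ gsDomain m k) {A B : Finset (Fin m)} (hAB : Disjoint A B) :
    x A + y B ≤ x (optimalBundle k (x, y)) + y (optimalBundle k (x, y))ᶜ := by
  have h1 : y B ≤ y Aᶜ := hy.2.1 (by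
    rw [Finset.subset_compl_iff_disjoint_left]
    exact hAB)
  refine le_trans (add_le_add le_rfl h1) ?_
  by_contra! hcon
  have h2 := perturbedWelfare_gap_of_lt hx.2.2.2 hy.2.2.2 hcon
  have h3 := le_perturbedWelfare_optimalBundle (k := k) x y A
  have : (0 : ℝ) < 1 / 2 ^ (4 * k + m + 1) := by positivity
  linarith

/-! ## Price certificates -/

/-- The price increment. -/
noncomputable def increment (m k : ℕ) : ℝ := 1 / 2 ^ (4 * k + 2 * m + 5)

/-- A certificate: prices and a bundle for the first player. -/
abbrev Certificate (m k : ℕ) : Type :=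
  (Fin m → Fin (2 ^ (5 * k + 2 * m + 7))) × Finset (Fin m)

/-- The prices of a certificate. -/
noncomputable def Certificate.price (c : Certificate m k) (j : Fin m) : ℝ :=
  increment m k * (c.1 j : ℕ)

/-- The valuations of the first player that almost demand the bundle of the certificate. -/
def acceptFirst (c : Certificate m k) : Set (Finset (Fin m) → ℝ) :=
  {x | x ∈ gsDomain m k ∧ ∀ T, perturbed k x T - ∑ j ∈ T, c.price j ≤
    perturbed k x c.2 - ∑ j ∈ c.2, c.price j + m * increment m k}

/-- The valuations of the second player that almost demand the complement of the bundle of the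
certificate. -/
def acceptSecond (c : Certificate m k) : Set (Finset (Fin m) → ℝ) :=
  {y | y ∈ gsDomain m k ∧ ∀ T, y T - ∑ j ∈ T, c.price j ≤
    y c.2ᶜ - ∑ j ∈ c.2ᶜ, c.price j + m * increment m k}

theorem two_mul_increment_lt : 2 * (m * increment m k) < 1 / 2 ^ (4 * k + m + 1) := by
  unfold increment
  have h1 : (m : ℝ) < 2 ^ m := by exact_mod_cast Nat.lt_two_pow_self
  have e : (1 : ℝ) / 2 ^ (4 * k + m + 1) = 2 ^ (m + 4) / 2 ^ (4 * k + 2 * m + 5) := by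
    rw [div_eq_div_iff (by positivity) (by positivity), one_mul, ← pow_add]
    congr 1
    ring
  rw [e, mul_one_div, mul_div_assoc', div_lt_div_iff_of_pos_right (by positivity), pow_add]
  have : (0 : ℝ) < 2 ^ m := by positivity
  linarith

/-- Adding the two approximate demand conditions cancels the prices, so the certified split is
within `2 * (m * increment m k)` of the perturbed optimum. That is below the gap, so the bundles
coincide. -/
theorem eq_optimalBundle_of_accept {c : Certificate m k} {x y : Finset (Fin m) → ℝ}
    (hx : x ∈ acceptFirst c) (hy : y ∈ acceptSecond c) : c.2 = optimalBundle k (x, y) := by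
  by_contra hne
  have h1 := perturbedWelfare_gap hx.1.2.2.2 hy.1.2.2.2 (Ne.symm hne)
    (le_perturbedWelfare_optimalBundle x y c.2)
  have h2 := hx.2 (optimalBundle k (x, y))
  have h3 := hy.2 (optimalBundle k (x, y))ᶜ
  have h4 := Finset.sum_add_sum_compl c.2 c.price
  have h5 := Finset.sum_add_sum_compl (optimalBundle k (x, y)) c.price
  have h6 := two_mul_increment_lt (m := m) (k := k)
  unfold perturbedWelfare at h1
  linarith

theorem value_lt_two_pow {x : Finset (Fin m) → ℝ} (hx : HasBitValues k x) (S : Finset (Fin m)) :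
    0 ≤ x S ∧ x S ≤ 2 ^ k := by
  obtain ⟨a, b, ha, hb, -, h⟩ := hx S
  have hb1 : (1 : ℝ) ≤ b := by exact_mod_cast hb
  rw [h]
  refine ⟨by positivity, (div_le_self (by positivity) hb1).trans ?_⟩
  exact_mod_cast ha.le

/-- The perturbation is additive, so it preserves gross substitutes and the auction applies. Unsold
items have price zero and can be handed to the second player, whose valuation is monotone. -/
theorem exists_certificate {x y : Finset (Fin m) → ℝ} (hx : x ∈ gsDomain m k)
    (hy : y ∈ gsDomain m k) : ∃ c : Certificate m k, x ∈ acceptFirst c ∧ y ∈ acceptSecond c := by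
  have hδ : (0 : ℝ) < increment m k := by unfold increment; positivity
  have hgs : ∀ i, IsGrossSubstitutes ((![perturbed k x, y] : Fin 2 → Finset (Fin m) → ℝ) i) := by
    intro i
    fin_cases i
    · exact hx.2.2.1.add_additive _
    · exact hy.2.2.1
  have hone : (1 : ℝ) / 2 ^ (4 * k) ≤ 1 := by
    rw [div_le_one (by positivity)]
    exact one_le_pow₀ one_le_two
  have hη : (0 : ℝ) < 1 / 2 ^ (4 * k + m + 1) := by positivity
  have hb : ∀ i S, ∀ j ∈ S, (![perturbed k x, y] : Fin 2 → Finset (Fin m) → ℝ) i S -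
      (![perturbed k x, y] : Fin 2 → Finset (Fin m) → ℝ) i (S.erase j) ≤ 2 ^ k + 1 := by
    intro i S j _
    fin_cases i
    · simp only [Fin.zero_eta, Matrix.cons_val_zero, perturbed]
      have h1 := value_lt_two_pow hx.2.2.2 S
      have h2 := value_lt_two_pow hx.2.2.2 (S.erase j)
      have h3 := tieWeight_lt (k := k) S
      have h4 := tieWeight_lt (k := k) (S.erase j)
      linarith [h3.2, h4.1, h1.2, h2.1]
    · simp only [Fin.mk_one, Matrix.cons_val_one, Matrix.cons_val_zero]
      have h1 := value_lt_two_pow hy.2.2.2 S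
      have h2 := value_lt_two_pow hy.2.2.2 (S.erase j)
      linarith [h1.2, h2.1]
  obtain ⟨q, S, hd, hq, hun, hdem⟩ := exists_approximate_equilibrium hgs hδ (by positivity) hb
  have hqlt : ∀ j, q j < 2 ^ (5 * k + 2 * m + 7) := by
    intro j
    have h1 := hq j
    unfold increment at h1
    rw [one_div_mul_eq_div, div_le_iff₀ (by positivity)] at h1
    have h2 : (1 : ℝ) ≤ 2 ^ k := one_le_pow₀ one_le_two
    have h3 : ((2 : ℝ) ^ k + 1) * 2 ^ (4 * k + 2 * m + 5) ≤
        (2 * 2 ^ k) * 2 ^ (4 * k + 2 * m + 5) := by gcongr; linarith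
    have h4 : ((2 : ℝ) * 2 ^ k) * 2 ^ (4 * k + 2 * m + 5) = 2 ^ (5 * k + 2 * m + 6) := by
      rw [← pow_succ', ← pow_add]
      congr 1
      ring
    have h5 : (q j : ℝ) ≤ ((2 ^ (5 * k + 2 * m + 6) : ℕ) : ℝ) := by
      push_cast
      linarith
    have h6 : q j ≤ 2 ^ (5 * k + 2 * m + 6) := by exact_mod_cast h5
    exact lt_of_le_of_lt h6 (Nat.pow_lt_pow_right one_lt_two (by omega))
  refine ⟨(fun j => ⟨q j, hqlt j⟩, S 0), ⟨hx, fun T => ?_⟩, hy, fun T => ?_⟩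
  · simpa [Certificate.price] using hdem 0 T
  · have h1 := hdem 1 T
    have hsub : S 1 ⊆ (S 0)ᶜ := by
      rw [Finset.subset_compl_iff_disjoint_left]
      exact hd
    have h2 : y (S 1) ≤ y (S 0)ᶜ := hy.2.1 hsub
    have h3 : ∑ j ∈ S 1, increment m k * (q j : ℝ) = ∑ j ∈ (S 0)ᶜ, increment m k * (q j : ℝ) := by
      refine Finset.sum_subset hsub fun j hj hj1 => ?_
      rw [hun j (by
        intro i
        fin_cases i
        · exact Finset.mem_compl.mp hj
        · exact hj1)]
      simp
    simp only [Matrix.cons_val_one, Matrix.cons_val_zero, Fintype.card_fin] at h1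
    simp only [Certificate.price]
    linarith

theorem card_certificate_lt :
    Fintype.card (Certificate m k) + 1 ≤ 2 ^ (m * (5 * k + 2 * m + 8) + 1) := by
  have h : Fintype.card (Certificate m k) = 2 ^ (m * (5 * k + 2 * m + 8)) := by
    simp only [Fintype.card_prod, Fintype.card_fun, Fintype.card_fin, Fintype.card_finset]
    rw [← pow_mul, ← pow_add]
    congr 1
    ring
  rw [h, pow_succ]
  have : 0 < 2 ^ (m * (5 * k + 2 * m + 8)) := by positivity
  omega

/-! ## The mechanism with externality payments -/

/-- The number encoded by a numerator and a denominator. -/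
noncomputable def decodeValue (c : Fin (2 ^ k) × Fin (2 ^ k)) : ℝ := (c.1 : ℕ) / (c.2 : ℕ)

/-- A numerator and a denominator of the value of a bundle. -/
noncomputable def encodeValue (k : ℕ) (x : Finset (Fin m) → ℝ) (S : Finset (Fin m)) :
    Fin (2 ^ k) × Fin (2 ^ k) :=
  by classical exact if h : ∃ c : Fin (2 ^ k) × Fin (2 ^ k), decodeValue c = x S then h.choose
    else default

theorem decodeValue_encodeValue {x : Finset (Fin m) → ℝ} (hx : HasBitValues k x)
    (S : Finset (Fin m)) : decodeValue (encodeValue k x S) = x S := by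
  obtain ⟨a, b, ha, -, hb, h⟩ := hx S
  have hex : ∃ c : Fin (2 ^ k) × Fin (2 ^ k), decodeValue c = x S :=
    ⟨(⟨a, ha⟩, ⟨b, hb⟩), by simp [decodeValue, h]⟩
  unfold encodeValue
  rw [dif_pos hex]
  exact hex.choose_spec

/-- The allocation of `T` to the first and `Tᶜ` to the second player, with payments `p` and `p'`
unless the bundle is empty. -/
noncomputable def splitOutcome (T : Finset (Fin m)) (p p' : ℝ) : Outcome (Fin 2) (Fin m) where
  bundle := ![T, Tᶜ]
  disjoint := by
    intro i j hij
    fin_cases i <;> fin_cases j <;>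
      simp_all [disjoint_compl_right, disjoint_compl_left]
  payment := ![if T = ∅ then 0 else p, if Tᶜ = ∅ then 0 else p']

/-- The outcome with the optimal allocation where each player pays his externality. -/
def IsExternalityOutcome (k : ℕ) (x y : Finset (Fin m) → ℝ) (o : Outcome (Fin 2) (Fin m)) : Prop :=
  o.bundle 0 = optimalBundle k (x, y) ∧ o.bundle 1 = (optimalBundle k (x, y))ᶜ ∧
    o.payment 0 = y Finset.univ - y (optimalBundle k (x, y))ᶜ ∧
    o.payment 1 = x Finset.univ - x (optimalBundle k (x, y))

theorem achieves_isExternalityOutcome (m k : ℕ) :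
    Achieves (fun o : Outcome (Fin 2) (Fin m) => ∀ i, o.bundle i = ∅ → o.payment i = 0)
      (IsExternalityOutcome k) (gsDomain m k ×ˢ gsDomain m k)
      (m * ((m * (5 * k + 2 * m + 8) + 1) * (2 * (m * (5 * k + 2 * m + 8) + 1))) +
        (4 * k + 4 * k + 0)) := by
  have hfin : ∀ T, Achieves
      (fun o : Outcome (Fin 2) (Fin m) => ∀ i, o.bundle i = ∅ → o.payment i = 0)
      (IsExternalityOutcome k)
      {p | p ∈ gsDomain m k ×ˢ gsDomain m k ∧ optimalBundle k p = T} (4 * k + 4 * k + 0) := by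
    intro T
    have hcard : Fintype.card ((Fin (2 ^ k) × Fin (2 ^ k)) × (Fin (2 ^ k) × Fin (2 ^ k))) ≤
        2 ^ (4 * k) := by
      simp only [Fintype.card_prod, Fintype.card_fin]
      rw [← pow_add, ← pow_add]
      exact Nat.pow_le_pow_right two_pos (by omega)
    refine achieves_messages (fun x => (encodeValue k x T, encodeValue k x Finset.univ))
      (fun y => (encodeValue k y Tᶜ, encodeValue k y Finset.univ)) hcard hcard fun a b => ?_
    refine achieves_leaf (splitOutcome T (decodeValue b.2 - decodeValue b.1)
      (decodeValue a.2 - decodeValue a.1)) ?_ ?_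
    · intro i hi
      fin_cases i
      · have : T = ∅ := hi
        simp [splitOutcome, this]
      · have : Tᶜ = ∅ := hi
        simp [splitOutcome, this]
    · rintro x y ⟨⟨⟨hx, hy⟩, hT⟩, rfl, rfl⟩
      simp only [decodeValue_encodeValue hx.2.2.2, decodeValue_encodeValue hy.2.2.2]
      unfold IsExternalityOutcome
      rw [hT]
      refine ⟨rfl, rfl, ?_, ?_⟩
      · simp only [splitOutcome, Matrix.cons_val_zero]
        split_ifs with h
        · simp [h]
        · rfl
      · simp only [splitOutcome, Matrix.cons_val_one, Matrix.cons_val_zero]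
        split_ifs with h
        · have : T = Finset.univ := by rwa [Finset.compl_eq_empty_iff] at h
          simp [this]
        · rfl
  have := achieves_of_colour acceptFirst acceptSecond (gsDomain m k ×ˢ gsDomain m k)
    (fun c : Certificate m k => c.2) (optimalBundle k) card_certificate_lt ?_ ?_ ?_ hfin
    Finset.univ ∅
  · refine this.mono (fun p hp => ⟨hp, fun i hi => absurd (Finset.mem_univ i) hi⟩) ?_
    simp
  · intro a b hab
    by_contra! hcon
    rw [Set.not_disjoint_iff, Set.not_disjoint_iff] at hcon
    obtain ⟨⟨x, hxa, hxb⟩, y, hya, hyb⟩ := hcon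
    exact hab ((eq_optimalBundle_of_accept hxa hya).trans (eq_optimalBundle_of_accept hxb hyb).symm)
  · exact fun p hp => exists_certificate hp.1 hp.2
  · exact fun p _ a h0 h1 => eq_optimalBundle_of_accept h0 h1

theorem exPost_upper_bound :
    ∃ C d : ℕ, ∀ m k : ℕ, ∃ P : Mechanism (Fin 2) (Fin m), P.IsNormalized ∧
      P.ImplementsInExPostEquilibrium (gsDomain m k) ∧ P.cost ≤ C * (m + k + 1) ^ d := by
  refine ⟨136, 5, fun m k => ?_⟩
  obtain ⟨P, s, hcost, hnorm, hs⟩ := achieves_isExternalityOutcome m k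
  have hout : ∀ v : Fin 2 → Finset (Fin m) → ℝ, Mechanism.outcome P s v =
      P.play (Protocol.two (s 0 (v 0)) (s 1 (v 1))) := fun v => by
    unfold Mechanism.outcome
    rw [Protocol.eq_two fun i => s i (v i)]
  have hspec : ∀ v : Fin 2 → Finset (Fin m) → ℝ, (∀ i, v i ∈ gsDomain m k) →
      IsExternalityOutcome k (v 0) (v 1) (Mechanism.outcome P s v) := fun v hv => by
    rw [hout]
    exact hs _ _ ⟨hv 0, hv 1⟩
  refine ⟨P, fun b i => hnorm b i, ⟨s, ?_, ?_⟩, hcost.trans ?_⟩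
  · intro v hv i w hw
    have hv' : ∀ j, Function.update v i w j ∈ gsDomain m k := by
      intro j
      by_cases hj : j = i
      · subst hj
        simpa using hw
      · simpa [hj] using hv j
    obtain ⟨a0, a1, a2, a3⟩ := hspec v hv
    obtain ⟨b0, b1, b2, b3⟩ := hspec _ hv'
    fin_cases i
    · simp only [Fin.zero_eta, Outcome.profit] at *
      rw [a0, a2, b0, b2]
      -- Up to a term independent of his report, a player's profit is the true welfare of the chosen
      -- allocation; the untruthful report selects just another split.
      have := le_welfare_optimalBundle (hv 0) (hv 1)
        (disjoint_compl_right
          (a := optimalBundle k (Function.update v 0 w 0, Function.update v 0 w 1)))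
      simp only [Function.update_self, Function.update_of_ne (show (1 : Fin 2) ≠ 0 by decide)] at *
      linarith
    · simp only [Fin.mk_one, Outcome.profit] at *
      rw [a1, a3, b1, b3]
      have := le_welfare_optimalBundle (hv 0) (hv 1)
        (disjoint_compl_right
          (a := optimalBundle k (Function.update v 1 w 0, Function.update v 1 w 1)))
      simp only [Function.update_self, Function.update_of_ne (show (0 : Fin 2) ≠ 1 by decide)] at *
      linarith
  · intro v hv B hB
    obtain ⟨a0, a1, -, -⟩ := hspec v hv
    rw [Fin.sum_univ_two, Fin.sum_univ_two, a0, a1]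
    exact le_welfare_optimalBundle (hv 0) (hv 1) (hB (by decide))
  · set n := m + k + 1 with hn
    have h1 : m * (5 * k + 2 * m + 8) + 1 ≤ 8 * n ^ 2 := by nlinarith
    calc m * ((m * (5 * k + 2 * m + 8) + 1) * (2 * (m * (5 * k + 2 * m + 8) + 1))) +
          (4 * k + 4 * k + 0) ≤ n * ((8 * n ^ 2) * (2 * (8 * n ^ 2))) + 8 * n := by
          gcongr <;> omega
      _ = 128 * n ^ 5 + 8 * n := by ring
      _ ≤ 128 * n ^ 5 + 8 * n ^ 5 := by
          gcongr
          exact Nat.le_self_pow (by norm_num) n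
      _ = 136 * n ^ 5 := by ring

end ExPost

theorem mainTheorem3 :
    (∃ (c : ℝ) (K m₀ : ℕ), 0 < c ∧ ∀ m k : ℕ, m₀ ≤ m → K * Nat.clog 2 m ≤ k →
      ∀ P : Mechanism (Fin 2) (Fin m), P.IsNormalized →
        P.ImplementsInDominantStrategies (gsDomain m k) →
          (2 : ℝ) ^ (c * (m : ℝ)) ≤ (P.cost : ℝ)) ∧
    (∃ C d : ℕ, ∀ m k : ℕ, ∃ P : Mechanism (Fin 2) (Fin m), P.IsNormalized ∧
      P.ImplementsInExPostEquilibrium (gsDomain m k) ∧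
        P.cost ≤ C * (m + k + 1) ^ d) := by
  exact ⟨dominant_strategies_lower_bound, exPost_upper_bound⟩
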